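/- **Setting.** Let $\beta>1$, $b:=\max\{k\in\mathbb Z:k<\beta\}$, $S:=\{0,\frac1\beta,\dots,\frac b\beta,1\}$, $I_i:=(\frac i\beta,\frac{i+1}\beta)$ for $0\le i\le b-1$ and $I_b:=(\frac b\beta,1)$. Let $T=T_{-\beta}:[0,1]\to[0,1]$ be given by $T(x)=-\beta x+(i+1)$ on $I_i$. For $x\in[0,1]$ whose orbit never meets $S$, its itinerary $i'(x)\in\{0,\dots,b\}^{\mathbb Z_+}$, $\mathbb Z_+=\{0,1,2,\dots\}$, is defined by $(i'(x))_k=j$ iff $T^k(x)\in I_j$; put $i'(1)=s_0s_1s_2\cdots:=\lim_{x\to1-0}i'(x)$. On $S$ put $T(0)=1$, $T(1)=b+1-\beta$, and, for $1\le i\le b$, $T(\frac i\beta)=0$ if $i'(1)=(w0)^\infty$ for some finite word $w$, and $T(\frac i\beta)=1$ otherwise. The symbolic space $\Sigma_{-\beta}$ is the closure in $\{0,\dots,b\}^{\mathbb Z_+}$ of the set of all itineraries $i'(x)$ of points $x\in[0,1]$ whose $T$-orbit never meets $S$, with the shift $\sigma$ and the metric $d(\omega,\omega')=2^{-\min\{k:\omega_k\ne\omega'_k\}}$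 for $\omega\neq\omega'$ (and $d(\omega,\omega)=0$). A continuous map $f$ of a compact metric space $X$ satisfies the *one-way (W)-specification property with* $X_1,\dots,X_q$ if the $X_i$ are compact subsets of $X$ with 1. $f(X_i)\subset X_i$ for $1\le i\le q$; 2. $\bigcup_{i=1}^q X_i$ is the non-wandering set $\Omega(f)$, i.e. the set of all $x$ such that every neighbourhood $U$ of $x$ satisfies $U\cap f^{-n}(U)\neq\emptyset$ for some $n>0$; 3. for every $\epsilon>0$ there is an integer $M\ge0$ such that for all $k\ge1$, all $x_1\in X_{i(1)},\dots,x_k\in X_{i(k)}$ with $i(1)\le\dots\le i(k)$ and all integers $n_1,\dots,n_k\ge1$ there are $y\in X$ and integers $0\le M_1,\dots,M_{k-1}\le M$ with $$d\bigl(f^i(x_j),f^{\,i+\sum_{t=1}^{j-1}(n_t+M_t)}(y)\bigr)\le\epsilon\qquad(0\le i\le n_j-1,\ 1\le j\le k).$$ It satisfies the *one-way (W)-specification property* if it does so with some finite family $X_1,\dots,X_q$. Let $\Gamma_{-\beta}$ be the labelled directed graph with vertices $V_0,V_1,V_2,\dots$ that has an edge $V_i\xrightarrow{a}V_j$ exactly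 when the word $s_0\cdots s_{i-1}a$ is an initial word of some element of $\Sigma_{-\beta}$ and $j$ is the largest integer such that $s_0\cdots s_{j-1}$ is a suffix of $s_0\cdots s_{i-1}a$. An irreducible component is a class of mutually reachable vertices that contains at least one edge. **Proposition.** Let $\beta>1$ and suppose that $i'(1)$ is eventually periodic. Then $(\Sigma_{-\beta},\sigma)$ satisfies the one-way (W)-specification property. More precisely, $\Sigma_{-\beta}$ is the set of label sequences of all one-sided infinite paths in $\Gamma_{-\beta}$; the graph $\Gamma_{-\beta}$ has only finitely many irreducible components, which can be listed as $C_1,\dots,C_q$ such that every vertex of $C_p$ has a smaller index than every vertex of $C_{p'}$ whenever $p<p'$; and $(\Sigma_{-\beta},\sigma)$ satisfies the one-way (W)-specification property with $X_1,\dots,X_q$, where $X_p$ is the set of label sequences of all one-sided infinite paths that stay in $C_p$. -/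

import Mathlib

open Set Filter Topology

/-! ### The one-way (W)-specification property -/

/-- `x` is a non-wandering point of `f`. -/
def IsNonWandering {X : Type*} [TopologicalSpace X] (f : X → X) (x : X) : Prop :=
  ∀ U ∈ 𝓝 x, ∃ n : ℕ, 0 < n ∧ (U ∩ f^[n] ⁻¹' U).Nonempty

/-- `(X, f)` satisfies the one-way (W)-specification property with the family
`Xs 0, …, Xs (q - 1)` of subsets of `X`. In the last clause, `c j` is the index of the piece that
contains `x j`, `n j` is the length of the `j`-th orbit segment and `m j` is the length of the gap
after it (the gap after the last segment is never used). -/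
structure OneWayWSpecificationWith {X : Type*} [MetricSpace X] (f : X → X) {q : ℕ}
    (Xs : Fin q → Set X) : Prop where
  compact : ∀ i, IsCompact (Xs i)
  invariant : ∀ i, MapsTo f (Xs i) (Xs i)
  nonWandering : {x | IsNonWandering f x} = ⋃ i, Xs i
  specification : ∀ ε : ℝ, 0 < ε → ∃ M : ℕ,
    ∀ (k : ℕ) (c : Fin k → Fin q) (x : Fin k → X) (n : Fin k → ℕ),
      0 < k → Monotone c → (∀ j, x j ∈ Xs (c j)) → (∀ j, 0 < n j) →
      ∃ (y : X) (m : Fin k → ℕ), (∀ j, m j ≤ M) ∧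
        ∀ j : Fin k, ∀ i < n j,
          dist (f^[i] (x j)) (f^[i + ∑ t ∈ Finset.univ.filter (fun t => t < j), (n t + m t)] y) ≤ ε

/-- The one-way (W)-specification property of `(X, f)`. -/
def OneWayWSpecification {X : Type*} [MetricSpace X] (f : X → X) : Prop :=
  ∃ (q : ℕ) (Xs : Fin q → Set X), OneWayWSpecificationWith f Xs

/-! ### The `(-β)`-transformation and its symbolic space

Digits are natural numbers; since `0 ≤ β * x ≤ β` on `[0, 1]`, only the digits `0, …, b` with
`b = ⌈β⌉ - 1` (the largest integer smaller than `β`) occur for the points considered below. -/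

namespace NegBeta

/-- The set `{0, 1/β, …, b/β, 1}` of partition points. -/
def partitionPoints (β : ℝ) : Set ℝ :=
  {x | x = 1 ∨ ∃ j : ℕ, (j : ℝ) < β ∧ x = j / β}

/-- The points of `[0, 1]` whose `f`-orbit never meets the partition points. -/
def regularPoints (β : ℝ) (f : ℝ → ℝ) : Set ℝ :=
  {x | x ∈ Icc (0 : ℝ) 1 ∧ ∀ k : ℕ, f^[k] x ∉ partitionPoints β}

/-- The itinerary of `x` under `f`: its `k`-th term is the `j` with
`f^[k] x ∈ (j/β, (j+1)/β)`. It is used for regular points only. -/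
noncomputable def itinerary (β : ℝ) (f : ℝ → ℝ) (x : ℝ) : ℕ → ℕ :=
  fun k => ⌊β * f^[k] x⌋₊

/-- The transformation off the partition points: `x ↦ -β x + (i + 1)` on `(i/β, (i+1)/β)`. -/
noncomputable def branchMap (β : ℝ) (x : ℝ) : ℝ := -β * x + (⌊β * x⌋ + 1)

/-- The kneading sequence `i'(1)`: the limit of the itineraries of regular points `x → 1-`
(in the product topology of the discrete space of digits). -/
noncomputable def kneading (β : ℝ) : ℕ → ℕ :=
  limUnder (𝓝[regularPoints β (branchMap β) ∩ Iio 1] (1 : ℝ)) (itinerary β (branchMap β))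

/-- `s = (w0)^∞` for some finite (possibly empty) word `w`. -/
def IsPeriodicEndingInZero (s : ℕ → ℕ) : Prop :=
  ∃ p : ℕ, (∀ k, s (k + (p + 1)) = s k) ∧ s p = 0

open Classical in
/-- The `(-β)`-transformation on `[0, 1]` (values outside of `[0, 1]` play no role).
Its value at `1` is the left limit `-β + (b + 1) = ⌈β⌉ - β`. -/
noncomputable def transformation (β : ℝ) (x : ℝ) : ℝ :=
  if x = 1 then ⌈β⌉ - β
  else if x = 0 then 1
  else if x ∈ partitionPoints β then
    (if IsPeriodicEndingInZero (kneading β) then 0 else 1)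
  else branchMap β x

/-- The symbolic space `Σ_{-β}`: the closure of the set of all itineraries of regular points. -/
def symbolicSpace (β : ℝ) : Set (ℕ → ℕ) :=
  closure (itinerary β (transformation β) '' regularPoints β (transformation β))

/-- The shift map on one-sided sequences. -/
def shift (ω : ℕ → ℕ) : ℕ → ℕ := fun k => ω (k + 1)

theorem shift_mapsTo (β : ℝ) : MapsTo shift (symbolicSpace β) (symbolicSpace β) := by
  intro ω hω
  refine map_mem_closure (f := shift) (by unfold shift; fun_prop) hω ?_
  rintro _ ⟨x, ⟨hx, hr⟩, rfl⟩
  have hr1 : ∀ k, (transformation β)^[k] (transformation β x) ∉ partitionPoints β :=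
    fun k => by simpa [Function.iterate_succ_apply] using hr (k + 1)
  have h0 : x ∉ partitionPoints β := hr 0
  have hx1 : x ≠ 1 := fun h => h0 (Or.inl h)
  have hx0 : x ≠ 0 := fun h => hr1 0 (Or.inl (by simp [transformation, h]))
  refine ⟨transformation β x, ⟨?_, hr1⟩, ?_⟩
  · have e : transformation β x = branchMap β x := by
      simp [transformation, hx1, hx0, h0]
    rw [e, branchMap]
    have h1 := Int.floor_le (β * x)
    have h2 := Int.lt_floor_add_one (β * x)
    constructor <;> linarith
  · funext k
    simp [itinerary, shift, Function.iterate_succ_apply]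

/-- The shift map of the symbolic space. -/
def shiftOn (β : ℝ) : symbolicSpace β → symbolicSpace β :=
  (shift_mapsTo β).restrict

/-- The metric on the symbolic space: `d(ω, ω') = 2^{-t}` for `ω ≠ ω'`, where `t` is the smallest
index at which `ω` and `ω'` differ. -/
noncomputable instance symbolicSpaceMetric (β : ℝ) : MetricSpace (symbolicSpace β) :=
  @Subtype.metricSpace (ℕ → ℕ) (· ∈ symbolicSpace β) PiNat.metricSpaceNatNat

theorem symbolicSpace_dist_eq (β : ℝ) (x y : symbolicSpace β) (h : x ≠ y) :
    dist x y = (1 / 2 : ℝ) ^ PiNat.firstDiff (E := fun _ => ℕ) x.1 y.1 :=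
  PiNat.dist_eq_of_ne (E := fun _ => ℕ) (fun e => h (Subtype.ext e))

/-- `s` is eventually periodic. -/
def EventuallyPeriodic (s : ℕ → ℕ) : Prop :=
  ∃ u v : ℕ, 0 < v ∧ ∀ k, u ≤ k → s (k + v) = s k

/-! ### The labelled graph `Γ_{-β}` -/

/-- The word `s_0 ⋯ s_{i-1}`. -/
def initialWord (s : ℕ → ℕ) (i : ℕ) : List ℕ := (List.range i).map s

/-- The language of a subshift: the words whose cylinder set is non-empty. -/
def language (X : Set (ℕ → ℕ)) : Set (List ℕ) :=
  {w | ∃ ω ∈ X, initialWord ω w.length = w}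

/-- `Edge β i a j`: there is an edge `V_i → V_j` with label `a` in the graph `Γ_{-β}` with vertices
`V_0, V_1, …`. With `s = i'(1)`, this means that `s_0 ⋯ s_{i-1} a` is a word of the language of
the symbolic space and `s_0 ⋯ s_{j-1}` is its suffix of maximal length among the initial words
of `s`. (For `a = s_i` this is the edge `V_i → V_{i+1}`; the other labels `a` that occur satisfy
`a < s_i` if `i` is even and `s_i < a ≤ s_0` if `i` is odd.) -/
def Edge (β : ℝ) (i a j : ℕ) : Prop :=
  initialWord (kneading β) i ++ [a] ∈ language (symbolicSpace β) ∧
    IsGreatest {l | initialWord (kneading β) l <:+ initialWord (kneading β) i ++ [a]} j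

/-- There is a path with at least one edge from `V_i` to `V_j`. -/
def Reaches (β : ℝ) : ℕ → ℕ → Prop :=
  Relation.TransGen (fun i j => ∃ a, Edge β i a j)

/-- `C` is (the vertex set of) an irreducible component of the graph: a class of mutually
reachable vertices containing at least one edge. -/
def IsIrreducibleComponent (β : ℝ) (C : Set ℕ) : Prop :=
  ∃ i, Reaches β i i ∧ C = {j | Reaches β i j ∧ Reaches β j i}

/-- The label sequences of all one-sided infinite paths that only visit vertices in `C`. -/
def pathLabels (β : ℝ) (C : Set ℕ) : Set (ℕ → ℕ) :=
  {ω | ∃ v : ℕ → ℕ, (∀ k, v k ∈ C) ∧ ∀ k, Edge β (v k) (ω k) (v (k + 1))}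

end NegBeta

/-! Write s for the kneading sequence i'(1). The problem becomes combinatorial once Σ is identified
with the sequences all of whose shifts are at most s in the alternating order
(`symbolicSpace_eq_admissible`). One inclusion holds because branches of iterates of T near 1 are
affine with slope (-β)^n. The other pulls a point back through inverse branches, keeping it on the
correct side of the left limits of the orbit of 1 (`exists_regular_of_borders`).

The vertex reached by a word is its longest suffix that is an initial word of s. It determines the
admissible continuations (`followers`) and, with the next letter, the next vertex, so Γ presents Σ
deterministically. The spine edges V_i → V_{i+1} always exist; hence the vertices reachable from a
given one are closed upwards, and components are ordered by index.

Let s have eventual period v from index u on, with v even after doubling. This gives finiteness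
twice: vertices far out that differ by v have the same followers (`followers_add_period`), and an
edge leaving the spine ends at index at most u + v (`IsKneadingBound.step_le`). As T is expanding, s
is not isolated in Σ, so such edges exist arbitrarily far out. Thus every vertex reaches V_{u+v},
all vertices from there on lie in one last component, every component meets [0, u+v], and connecting
words can be chosen of bounded length (`exists_connects_le`). Gluing along them gives specification.

For the non-wandering set, the path of ω ends up in one component, and a return of its initial words
usually yields a path for ω inside that component. The exception is a return inside a copy of s; it
is harmless because every tail of s labels a path in the last component (`tail_mem_labels_top`). -/

namespace NegBeta

/-! ### Sequences bounded by `s` in the alternating order -/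

/-- `ω` is at most `s` in the alternating lexicographic order. -/
def AltLe (s ω : ℕ → ℕ) : Prop :=
  ∀ n, (∀ t < n, ω t = s t) → (Even n → ω n ≤ s n) ∧ (Odd n → s n ≤ ω n)

/-- The sequences all of whose shifts are at most `s` in the alternating order. -/
def Admissible (s : ℕ → ℕ) : Set (ℕ → ℕ) :=
  {ω | ∀ k, AltLe s (fun t => ω (k + t))}

/-- The sequence that starts with the first `n` terms of `ζ` and continues with `y`. -/
def splice (ζ : ℕ → ℕ) (n : ℕ) (y : ℕ → ℕ) : ℕ → ℕ :=
  fun k => if k < n then ζ k else y (k - n)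

theorem splice_of_lt {ζ y : ℕ → ℕ} {n k : ℕ} (h : k < n) : splice ζ n y k = ζ k := if_pos h

theorem splice_add (ζ y : ℕ → ℕ) (n k : ℕ) : splice ζ n y (n + k) = y k := by
  simp [splice]

/-- The word of the first `l` terms of `s` is a suffix of the word of the first `n` terms of
`ζ`. -/
def IsBorder (s ζ : ℕ → ℕ) (n l : ℕ) : Prop :=
  l ≤ n ∧ ∀ t < l, ζ (n - l + t) = s t

open Classical in
/-- The length of the longest initial word of `s` that is a suffix of the word of the first `n`
terms of `ζ`. -/
noncomputable def border (s ζ : ℕ → ℕ) (n : ℕ) : ℕ :=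
  Nat.findGreatest (IsBorder s ζ n) n

/-- The sequences that may follow the word of the first `i` terms of `s`. -/
def followers (s : ℕ → ℕ) (i : ℕ) : Set (ℕ → ℕ) := {y | splice s i y ∈ Admissible s}

variable {s ζ ζ' y : ℕ → ℕ} {n l m i j a : ℕ}

theorem isBorder_border (s ζ : ℕ → ℕ) (n : ℕ) : IsBorder s ζ n (border s ζ n) := by
  classical
  have h0 : IsBorder s ζ n 0 := ⟨Nat.zero_le _, by simp⟩
  exact Nat.findGreatest_spec (P := IsBorder s ζ n) (Nat.zero_le n) h0

theorem IsBorder.le_border (h : IsBorder s ζ n l) : l ≤ border s ζ n := by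
  classical
  exact Nat.le_findGreatest h.1 h

theorem isBorder_congr (h : ∀ t < n, ζ t = ζ' t) : IsBorder s ζ n l ↔ IsBorder s ζ' n l := by
  refine and_congr_right fun hl => forall₂_congr fun t ht => ?_
  rw [h _ (by omega)]

theorem border_eq_of_forall (h : ∀ l, IsBorder s ζ n l ↔ IsBorder s ζ' m l) :
    border s ζ n = border s ζ' m :=
  le_antisymm ((h _).1 (isBorder_border s ζ n)).le_border
    ((h _).2 (isBorder_border s ζ' m)).le_border

theorem border_congr (h : ∀ t < n, ζ t = ζ' t) : border s ζ n = border s ζ' n :=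
  border_eq_of_forall fun _ => isBorder_congr h

theorem border_of_eq (h : ∀ t < n, ζ t = s t) : border s ζ n = n := by
  refine le_antisymm (isBorder_border s ζ n).1 (IsBorder.le_border ⟨le_rfl, fun t ht => ?_⟩)
  simpa using h t ht

/-- Every border is a suffix of the longest one, which is itself an initial word of `s`. Hence the
longest border alone determines all borders, which is what makes it a state of an automaton. -/
theorem isBorder_iff_of_border (m : ℕ) (hm : border s ζ n = m) :
    IsBorder s ζ n l ↔ IsBorder s s m l := by
  subst hm
  have hb := isBorder_border s ζ n
  have key : ∀ l ≤ border s ζ n, ∀ t < l, ζ (n - l + t) = s (border s ζ n - l + t) := by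
    intro l hl t ht
    rw [← hb.2 (border s ζ n - l + t) (by omega)]
    congr 1
    have := hb.1
    omega
  constructor
  · intro h
    exact ⟨h.le_border, fun t ht => by rw [← key l h.le_border t ht]; exact h.2 t ht⟩
  · intro h
    exact ⟨h.1.trans hb.1, fun t ht => by rw [key l h.1 t ht]; exact h.2 t ht⟩

theorem isBorder_succ : IsBorder s ζ (n + 1) (l + 1) ↔ IsBorder s ζ n l ∧ ζ n = s l := by
  constructor
  · rintro ⟨h1, h2⟩
    have hl : l ≤ n := by omega
    refine ⟨⟨hl, fun t ht => ?_⟩, ?_⟩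
    · rw [← h2 t (by omega)]; congr 1; omega
    · rw [← h2 l (by omega)]; congr 1; omega
  · rintro ⟨⟨h1, h2⟩, h3⟩
    refine ⟨by omega, fun t ht => ?_⟩
    rcases Nat.lt_succ_iff_lt_or_eq.1 ht with h | rfl
    · rw [← h2 t h]; congr 1; omega
    · rw [← h3]; congr 1; omega

theorem isBorder_zero : IsBorder s ζ n 0 := ⟨Nat.zero_le _, by simp⟩

theorem border_succ_eq (h : border s ζ n = border s ζ' m) (h' : ζ n = ζ' m) :
    border s ζ (n + 1) = border s ζ' (m + 1) := by
  refine border_eq_of_forall fun l => ?_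
  cases l with
  | zero => simp [isBorder_zero]
  | succ l =>
    rw [isBorder_succ, isBorder_succ, isBorder_iff_of_border _ h,
      isBorder_iff_of_border (ζ := ζ') _ rfl, h']

/-- Borders of length at most `k` only see the last `k` letters. -/
theorem isBorder_shift_iff {k : ℕ} (hl : l ≤ k) :
    IsBorder s ζ (n + k) l ↔ IsBorder s (fun t => ζ (n + t)) k l := by
  refine and_congr (by omega) (forall₂_congr fun t ht => ?_)
  have : n + k - l + t = n + (k - l + t) := by omega
  rw [this]

theorem border_shift_of_le {k : ℕ} (h : border s ζ (n + k) ≤ k) :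
    border s ζ (n + k) = border s (fun t => ζ (n + t)) k :=
  le_antisymm ((isBorder_shift_iff h).1 (isBorder_border s ζ _)).le_border
    ((isBorder_shift_iff (isBorder_border s _ k).1).2 (isBorder_border s _ k)).le_border

/-! ### Splicing admissible sequences -/

theorem Admissible.shift (h : ζ ∈ Admissible s) (n : ℕ) :
    (fun t => ζ (n + t)) ∈ Admissible s := by
  intro k
  simpa only [add_assoc] using h (n + k)

theorem splice_shift_eq (s y : ℕ → ℕ) (h : IsBorder s ζ n l) (t : ℕ) :
    splice ζ n y (n - l + t) = splice s l y t := by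
  have := h.1
  by_cases ht : t < l
  · rw [splice_of_lt ht, splice_of_lt (by omega), h.2 t ht]
  · obtain ⟨r, rfl⟩ := Nat.exists_eq_add_of_le (not_lt.1 ht)
    rw [splice_add, show n - l + (l + r) = n + r by omega, splice_add]

/-- A comparison that starts inside `ζ` is decided there unless the rest of the word agrees with
`s`, that is, unless it is a border. So only borders constrain the continuation. -/
theorem mem_admissible_splice_iff (hζ : ζ ∈ Admissible s) :
    splice ζ n y ∈ Admissible s ↔
      y ∈ Admissible s ∧ ∀ l, IsBorder s ζ n l → AltLe s (splice s l y) := by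
  constructor
  · intro h
    refine ⟨by simpa only [splice_add] using Admissible.shift h n, fun l hl => ?_⟩
    simpa only [splice_shift_eq s y hl] using h (n - l)
  · rintro ⟨hy, hb⟩ k p hp
    by_cases hkp : k + p < n
    · simp only [splice_of_lt hkp]
      refine hζ k p fun t ht => ?_
      have := hp t ht
      simpa only [splice_of_lt (show k + t < n by omega)] using this
    · by_cases hk : k ≤ n
      · have hbd : IsBorder s ζ n (n - k) := by
          refine ⟨by omega, fun t ht => ?_⟩
          have := hp t (by omega)
          rw [← this]
          simp only [show n - (n - k) + t = k + t by omega]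
          rw [splice_of_lt (by omega)]
        have e : ∀ t, splice ζ n y (k + t) = splice s (n - k) y t := by
          intro t
          rw [← splice_shift_eq s y hbd]
          congr 1; omega
        simp only [e] at hp ⊢
        exact hb _ hbd p hp
      · obtain ⟨r, rfl⟩ := Nat.exists_eq_add_of_le (not_le.1 hk).le
        simp only [add_assoc, splice_add] at hp ⊢
        exact hy r p hp

theorem admissible_splice (hζ : ζ ∈ Admissible s) (hy : y ∈ followers s (border s ζ n))
    (hs : s ∈ Admissible s) : splice ζ n y ∈ Admissible s := by
  rw [mem_admissible_splice_iff hζ]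
  obtain ⟨h1, h2⟩ := (mem_admissible_splice_iff hs).1 hy
  exact ⟨h1, fun l hl => h2 l ((isBorder_iff_of_border _ rfl).1 hl)⟩

theorem shift_mem_followers (hζ : ζ ∈ Admissible s) (n : ℕ) :
    (fun t => ζ (n + t)) ∈ followers s (border s ζ n) := by
  have hb := isBorder_border s ζ n
  suffices h : splice s (border s ζ n) (fun t => ζ (n + t)) =
      fun t => ζ (n - border s ζ n + t) by
    rw [followers, mem_ofPred_eq, h]
    exact Admissible.shift hζ _
  funext t
  rw [← splice_shift_eq s _ hb]
  by_cases h : n - border s ζ n + t < n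
  · rw [splice_of_lt h]
  · obtain ⟨r, hr⟩ := Nat.exists_eq_add_of_le (not_lt.1 h)
    rw [hr, splice_add]

theorem mem_admissible_of_mem_followers (h : y ∈ followers s i) : y ∈ Admissible s := by
  simpa only [splice_add] using Admissible.shift (show splice s i y ∈ Admissible s from h) i

theorem mem_followers_zero : y ∈ followers s 0 ↔ y ∈ Admissible s := by
  have : splice s 0 y = y := by funext t; simp [splice]
  simp [followers, this]

/-- Membership in `Admissible s` only depends on the finite initial words. -/
theorem admissible_of_forall_exists (h : ∀ N, ∃ ω ∈ Admissible s, ∀ t < N, ω t = ζ t) :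
    ζ ∈ Admissible s := by
  intro k n hn
  obtain ⟨ω, hω, he⟩ := h (k + n + 1)
  have := hω k n fun t ht => by simpa only [he (k + t) (by omega)] using hn t ht
  simpa only [he (k + n) (by omega)] using this

/-! ### Eventually periodic bounds -/

theorem altLe_splice_iff (s : ℕ → ℕ) (m : ℕ) (y : ℕ → ℕ) : AltLe s (splice s m y) ↔
    ∀ n, (∀ t < n, y t = s (m + t)) →
      (Even (m + n) → y n ≤ s (m + n)) ∧ (Odd (m + n) → s (m + n) ≤ y n) := by
  constructor
  · intro h n hn
    have := h (m + n) fun t ht => by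
      by_cases htm : t < m
      · exact splice_of_lt htm
      · obtain ⟨r, rfl⟩ := Nat.exists_eq_add_of_le (not_lt.1 htm)
        rw [splice_add]; exact hn r (by omega)
    simpa only [splice_add] using this
  · intro h n hn
    by_cases hnm : n < m
    · rw [splice_of_lt hnm]; exact ⟨fun _ => le_rfl, fun _ => le_rfl⟩
    · obtain ⟨r, rfl⟩ := Nat.exists_eq_add_of_le (not_lt.1 hnm)
      rw [splice_add]
      refine h r fun t ht => ?_
      rw [← hn (m + t) (by omega), splice_add]

theorem altLe_splice_add_period {u v : ℕ} (hv : Even v) (hp : ∀ k, u ≤ k → s (k + v) = s k)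
    (hm : u ≤ m) : AltLe s (splice s (m + v) y) ↔ AltLe s (splice s m y) := by
  have e : ∀ t, s (m + v + t) = s (m + t) := fun t => by
    rw [show m + v + t = m + t + v by omega]; exact hp _ (by omega)
  have e1 : ∀ n, Even (m + v + n) ↔ Even (m + n) := fun n => by
    rw [show m + v + n = m + n + v by omega, Nat.even_add]; simp [hv]
  rw [altLe_splice_iff, altLe_splice_iff]
  simp only [e, ← Nat.not_even_iff_odd, e1]

/-- Both sequences repeat with period `v` from index `u` on, so their first `u + v` terms determine
them. -/
theorem eq_shift_of_agree {u v k : ℕ} (hp : ∀ k, u ≤ k → s (k + v) = s k)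
    (hv : 0 < v) (h : ∀ t < u + v, s t = s (k + t)) (t : ℕ) : s t = s (k + t) := by
  induction t using Nat.strong_induction_on with
  | _ t ih =>
    by_cases ht : t < u + v
    · exact h t ht
    · obtain ⟨r, rfl⟩ := Nat.exists_eq_add_of_le (not_lt.1 ht)
      rw [show u + v + r = u + r + v by omega, hp _ (by omega), ih (u + r) (by omega),
        ← hp (k + (u + r)) (by omega)]
      congr 1; omega

theorem isBorder_self_eq_shift {u v : ℕ} (hp : ∀ k, u ≤ k → s (k + v) = s k) (hv : 0 < v)
    (h : IsBorder s s i l) (hl : u + v ≤ l) (t : ℕ) : s t = s (i - l + t) :=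
  eq_shift_of_agree hp hv (fun t ht => (h.2 t (by omega)).symm) t

/-- Borders starting late (at `u` or beyond) occur with the same length for `i` and `i + v`. A
border starting earlier is so long that `s` equals its own shift there; lengthening it by `v` again
gives a border, and since `v` is even the constraint is the same. -/
theorem followers_add_period {u v : ℕ} (hs : s ∈ Admissible s) (hv : 0 < v) (hve : Even v)
    (hp : ∀ k, u ≤ k → s (k + v) = s k) (hi : 2 * u + 2 * v ≤ i) :
    followers s (i + v) = followers s i := by
  ext y
  simp only [followers, mem_ofPred_eq]
  rw [mem_admissible_splice_iff hs, mem_admissible_splice_iff hs]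
  refine and_congr_right fun _ => ⟨fun h l hl => ?_, fun h l hl => ?_⟩
  · by_cases hk : u ≤ i - l
    · refine h l ⟨by have := hl.1; omega, fun t ht => ?_⟩
      rw [← hl.2 t ht, ← hp (i - l + t) (by omega)]
      congr 1; have := hl.1; omega
    · rw [← altLe_splice_add_period hve hp (by omega)]
      refine h (l + v) ⟨by have := hl.1; omega, fun t ht => ?_⟩
      rw [isBorder_self_eq_shift hp hv hl (by omega) t]
      congr 1; omega
  · have hli := hl.1
    by_cases hk : u + v ≤ i + v - l
    · refine h l ⟨by omega, fun t ht => ?_⟩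
      rw [← hl.2 t ht, ← hp (i - l + t) (by omega)]
      congr 1; omega
    · obtain ⟨m, rfl⟩ : ∃ m, l = m + v := ⟨l - v, by omega⟩
      rw [altLe_splice_add_period hve hp (by omega)]
      refine h m ⟨by omega, fun t ht => ?_⟩
      rw [isBorder_self_eq_shift hp hv hl (by omega) t]
      congr 1; omega

/-! ### Regular points of the transformation -/

theorem mem_closure_iff_forall_agree {S : Set (ℕ → ℕ)} {ω : ℕ → ℕ} :
    ω ∈ closure S ↔ ∀ N, ∃ η ∈ S, ∀ t < N, η t = ω t := by
  let _ := PiNat.metricSpaceNatNat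
  constructor
  · intro h N
    obtain ⟨η, hη, hd⟩ := Metric.mem_closure_iff.1 h ((1 / 2) ^ N) (by positivity)
    refine ⟨η, hη, fun t ht => ?_⟩
    have := (PiNat.mem_cylinder_iff_dist_le (E := fun _ => ℕ)).2 (dist_comm ω η ▸ hd.le)
    exact this t ht
  · intro h
    refine Metric.mem_closure_iff.2 fun ε hε => ?_
    obtain ⟨N, hN⟩ := exists_pow_lt_of_lt_one hε (show (1 / 2 : ℝ) < 1 by norm_num)
    obtain ⟨η, hη, he⟩ := h N
    refine ⟨η, hη, lt_of_le_of_lt ?_ hN⟩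
    rw [dist_comm]
    exact (PiNat.mem_cylinder_iff_dist_le (E := fun _ => ℕ)).1 fun t ht => he t ht

theorem iterate_eq_of_eq_off {f g : ℝ → ℝ} {S : Set ℝ} (h : ∀ x, x ∉ S → g x = f x) {x : ℝ}
    (hx : ∀ k, f^[k] x ∉ S) (k : ℕ) : g^[k] x = f^[k] x := by
  induction k with
  | zero => rfl
  | succ k ih => rw [Function.iterate_succ_apply', Function.iterate_succ_apply', ih, h _ (hx k)]

variable {β : ℝ} {x : ℝ}

theorem transformation_eq_branchMap (hβ : 1 < β) {x : ℝ} (hx : x ∉ partitionPoints β) :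
    transformation β x = branchMap β x := by
  have h1 : x ≠ 1 := fun h => hx (Or.inl h)
  have h0 : x ≠ 0 := fun h => hx (Or.inr ⟨0, by simpa using by linarith, by simpa using h⟩)
  simp [transformation, h1, h0, hx]

/-- Orbits avoiding the partition points never see the special values there, so the case distinction
in `transformation` plays no role in the symbolic space. -/
theorem regularPoints_transformation (hβ : 1 < β) :
    regularPoints β (transformation β) = regularPoints β (branchMap β) := by
  have h1 := fun x (hx : x ∉ partitionPoints β) => transformation_eq_branchMap hβ hx
  ext x
  refine and_congr_right fun _ => ⟨fun h k => ?_, fun h k => ?_⟩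
  · rw [iterate_eq_of_eq_off (fun x hx => (h1 x hx).symm) h k]; exact h k
  · rw [iterate_eq_of_eq_off h1 h k]; exact h k

theorem itinerary_transformation (hβ : 1 < β) (hx : x ∈ regularPoints β (branchMap β)) :
    itinerary β (transformation β) x = itinerary β (branchMap β) x := by
  funext k
  rw [itinerary, itinerary,
    iterate_eq_of_eq_off (fun x hx => transformation_eq_branchMap hβ hx) hx.2 k]

theorem regular_pos (hβ : 1 < β) (hx : x ∈ regularPoints β (branchMap β)) : 0 < x :=
  lt_of_le_of_ne hx.1.1 fun h => hx.2 0 (Or.inr ⟨0, by simpa using by linarith, by simp [← h]⟩)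

theorem regular_lt_one (hx : x ∈ regularPoints β (branchMap β)) : x < 1 :=
  lt_of_le_of_ne hx.1.2 fun h => hx.2 0 (Or.inl h)

theorem regular_floor (hβ : 1 < β) (hx : x ∈ regularPoints β (branchMap β)) :
    (⌊β * x⌋ : ℤ) = (⌊β * x⌋₊ : ℤ) := by
  have := regular_pos hβ hx
  exact (Int.natCast_floor_eq_floor (by positivity)).symm

theorem digit_lt (hβ : 1 < β) (hx : x ∈ regularPoints β (branchMap β)) :
    (⌊β * x⌋₊ : ℝ) < β * x := by
  have h0 := regular_pos hβ hx
  have h1 := regular_lt_one hx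
  have hb : 0 < β := by linarith
  have h2 : (⌊β * x⌋₊ : ℝ) ≤ β * x := Nat.floor_le (by positivity)
  refine lt_of_le_of_ne h2 fun h => hx.2 0 (Or.inr ⟨⌊β * x⌋₊, ?_, ?_⟩)
  · calc (⌊β * x⌋₊ : ℝ) ≤ β * x := h2
      _ < β := by nlinarith
  · rw [h]; simp [hb.ne']

theorem branchMap_regular (hβ : 1 < β) (hx : x ∈ regularPoints β (branchMap β)) :
    branchMap β x = ⌊β * x⌋₊ + 1 - β * x := by
  have h : ((⌊β * x⌋ : ℤ) : ℝ) = (⌊β * x⌋₊ : ℝ) := by rw [regular_floor hβ hx]; simp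
  rw [branchMap, h]; ring

theorem regular_branchMap (hβ : 1 < β) (hx : x ∈ regularPoints β (branchMap β)) :
    branchMap β x ∈ regularPoints β (branchMap β) := by
  refine ⟨?_, fun k => ?_⟩
  · have h1 := digit_lt hβ hx
    have h2 := Nat.lt_floor_add_one (β * x)
    rw [branchMap_regular hβ hx]
    constructor <;> linarith
  · rw [← Function.iterate_succ_apply]; exact hx.2 _

theorem regular_iterate (hβ : 1 < β) (hx : x ∈ regularPoints β (branchMap β)) (n : ℕ) :
    (branchMap β)^[n] x ∈ regularPoints β (branchMap β) := by
  induction n with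
  | zero => exact hx
  | succ n ih => rw [Function.iterate_succ_apply']; exact regular_branchMap hβ ih

theorem itinerary_iterate (β x : ℝ) (f : ℝ → ℝ) (n t : ℕ) :
    itinerary β f (f^[n] x) t = itinerary β f x (n + t) := by
  rw [itinerary, itinerary, ← Function.iterate_add_apply, add_comm t n]

theorem digit_lt_iterate (hβ : 1 < β) (hx : x ∈ regularPoints β (branchMap β)) (n : ℕ) :
    (itinerary β (branchMap β) x n : ℝ) < β * (branchMap β)^[n] x :=
  digit_lt hβ (regular_iterate hβ hx n)

theorem iterate_lt_digit (β x : ℝ) (n : ℕ) :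
    β * (branchMap β)^[n] x < itinerary β (branchMap β) x n + 1 :=
  Nat.lt_floor_add_one _

theorem iterate_succ_regular (hβ : 1 < β) (hx : x ∈ regularPoints β (branchMap β)) (n : ℕ) :
    (branchMap β)^[n + 1] x =
      itinerary β (branchMap β) x n + 1 - β * (branchMap β)^[n] x := by
  rw [Function.iterate_succ_apply']
  exact branchMap_regular hβ (regular_iterate hβ hx n)

/-! ### Density of the regular points and existence of the kneading sequence -/

theorem countable_partitionPoints (β : ℝ) : (partitionPoints β).Countable := by
  refine ((countable_singleton (1 : ℝ)).union (countable_range fun j : ℕ => (j : ℝ) / β)).mono ?_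
  rintro x (h | ⟨j, -, rfl⟩)
  · exact Or.inl h
  · exact Or.inr ⟨j, rfl⟩

theorem countable_preimage_branchMap (hβ : 1 < β) {S : Set ℝ} (hS : S.Countable) :
    (branchMap β ⁻¹' S).Countable := by
  refine (countable_iUnion fun z : ℤ => hS.image fun y => ((z : ℝ) + 1 - y) / β).mono ?_
  intro x hx
  refine mem_iUnion.2 ⟨⌊β * x⌋, _, hx, ?_⟩
  have : β ≠ 0 := by linarith
  simp only [branchMap]
  field_simp
  ring

theorem countable_preimage_iterate (hβ : 1 < β) {S : Set ℝ} (hS : S.Countable) (k : ℕ) :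
    ((branchMap β)^[k] ⁻¹' S).Countable := by
  induction k with
  | zero => exact hS
  | succ k ih =>
    rw [Function.iterate_succ, preimage_comp]
    exact countable_preimage_branchMap hβ ih

/-- The points that hit the partition at some time form a countable set, so its complement is dense.
-/
theorem exists_regular_between (hβ : 1 < β) {c d : ℝ} (hcd : c < d) (hc : 0 ≤ c) (hd : d ≤ 1) :
    ∃ x ∈ regularPoints β (branchMap β), c < x ∧ x < d := by
  have hC : (⋃ k, (branchMap β)^[k] ⁻¹' partitionPoints β).Countable :=
    countable_iUnion fun k => countable_preimage_iterate hβ (countable_partitionPoints β) k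
  obtain ⟨x, hx, hx1, hx2⟩ := (hC.dense_compl ℝ).exists_between hcd
  refine ⟨x, ⟨⟨by linarith, by linarith⟩, fun k hk => hx (mem_iUnion.2 ⟨k, hk⟩)⟩, hx1, hx2⟩

/-- As `x` increases to 1, the value approaches `c` strictly from one side, given by the sign of
`e`, and one-sided limits of the floor are attained. This is why the kneading sequence exists. -/
theorem eventually_floor_affine (c : ℝ) {e : ℝ} (he : e ≠ 0) :
    ∃ d : ℤ, ∀ᶠ x in 𝓝[<] (1 : ℝ), ⌊c + e * (x - 1)⌋ = d := by
  have ht : Tendsto (fun x : ℝ => c + e * (x - 1)) (𝓝[<] 1) (𝓝 c) := by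
    have : Tendsto (fun x : ℝ => c + e * (x - 1)) (𝓝 1) (𝓝 (c + e * (1 - 1))) :=
      Continuous.tendsto (by fun_prop) _
    simp only [sub_self, mul_zero, add_zero] at this
    exact this.mono_left nhdsWithin_le_nhds
  have hlt : ∀ᶠ x in 𝓝[<] (1 : ℝ), x < 1 := self_mem_nhdsWithin
  rcases lt_or_gt_of_ne he with h | h
  · refine ⟨⌊c⌋, ?_⟩
    have h2 : Tendsto (fun x : ℝ => c + e * (x - 1)) (𝓝[<] 1) (𝓝[≥] c) :=
      tendsto_nhdsWithin_iff.2 ⟨ht, hlt.mono fun x hx => by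
        simp only [mem_Ici]; nlinarith⟩
    exact tendsto_pure.1 ((tendsto_floor_right_pure_floor c).comp h2)
  · refine ⟨⌈c⌉ - 1, ?_⟩
    have h2 : Tendsto (fun x : ℝ => c + e * (x - 1)) (𝓝[<] 1) (𝓝[<] c) :=
      tendsto_nhdsWithin_iff.2 ⟨ht, hlt.mono fun x hx => by
        simp only [mem_Iio]; nlinarith⟩
    exact tendsto_pure.1 ((tendsto_floor_left_pure_ceil_sub_one c).comp h2)

theorem eventually_iterate_affine (hβ : 1 < β) (n : ℕ) :
    ∃ c : ℝ, ∀ᶠ x in 𝓝[<] (1 : ℝ), x ∈ regularPoints β (branchMap β) →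
      (branchMap β)^[n] x = c + (-β) ^ n * (x - 1) := by
  induction n with
  | zero => exact ⟨1, Eventually.of_forall fun x _ => by simp⟩
  | succ n ih =>
    obtain ⟨c, hc⟩ := ih
    obtain ⟨d, hd⟩ := eventually_floor_affine (β * c) (e := β * (-β) ^ n)
      (mul_ne_zero (by linarith) (pow_ne_zero _ (by linarith)))
    refine ⟨d + 1 - β * c, ?_⟩
    filter_upwards [hc, hd] with x h1 h2 hx
    rw [Function.iterate_succ_apply', branchMap, h1 hx,
      show β * (c + (-β) ^ n * (x - 1)) = β * c + β * (-β) ^ n * (x - 1) by ring, h2]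
    ring

theorem eventually_itinerary_const (hβ : 1 < β) (n : ℕ) :
    ∃ d : ℕ, ∀ᶠ x in 𝓝[<] (1 : ℝ), x ∈ regularPoints β (branchMap β) →
      itinerary β (branchMap β) x n = d := by
  obtain ⟨c, hc⟩ := eventually_iterate_affine hβ n
  obtain ⟨d, hd⟩ := eventually_floor_affine (β * c) (e := β * (-β) ^ n)
    (mul_ne_zero (by linarith) (pow_ne_zero _ (by linarith)))
  refine ⟨d.toNat, ?_⟩
  filter_upwards [hc, hd] with x h1 h2 hx
  rw [itinerary, h1 hx,
    show β * (c + (-β) ^ n * (x - 1)) = β * c + β * (-β) ^ n * (x - 1) by ring, ← h2,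
    Int.floor_toNat]

theorem neBot_regular_left (hβ : 1 < β) :
    (𝓝[regularPoints β (branchMap β) ∩ Iio 1] (1 : ℝ)).NeBot := by
  rw [← mem_closure_iff_nhdsWithin_neBot, Metric.mem_closure_iff]
  intro ε hε
  obtain ⟨x, hx, h1, h2⟩ := exists_regular_between hβ (c := max 0 (1 - ε)) (d := 1)
    (max_lt one_pos (by linarith)) (le_max_left _ _) le_rfl
  refine ⟨x, ⟨hx, h2⟩, ?_⟩
  rw [Real.dist_eq, abs_of_pos (by linarith)]
  linarith [le_max_right 0 (1 - ε)]

theorem eventually_itinerary_eq_kneading (hβ : 1 < β) (n : ℕ) :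
    ∀ᶠ x in 𝓝[regularPoints β (branchMap β) ∩ Iio 1] (1 : ℝ),
      itinerary β (branchMap β) x n = kneading β n := by
  have := neBot_regular_left hβ
  choose w hw using eventually_itinerary_const hβ
  have hw' : ∀ n, ∀ᶠ x in 𝓝[regularPoints β (branchMap β) ∩ Iio 1] (1 : ℝ),
      itinerary β (branchMap β) x n = w n := by
    intro n
    have h1 := nhdsWithin_mono (1 : ℝ)
      (inter_subset_right : regularPoints β (branchMap β) ∩ Iio 1 ⊆ Iio 1) (hw n)
    filter_upwards [h1, self_mem_nhdsWithin] with x hx hx' using hx hx'.1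
  have ht : Tendsto (itinerary β (branchMap β))
      (𝓝[regularPoints β (branchMap β) ∩ Iio 1] (1 : ℝ)) (𝓝 w) :=
    tendsto_pi_nhds.2 fun n => tendsto_nhds_of_eventually_eq (hw' n)
  have : kneading β = w := ht.limUnder_eq
  rw [this]
  exact hw' n

theorem exists_regular_prefix (hβ : 1 < β) (N : ℕ) {δ : ℝ} (hδ : 0 < δ) :
    ∃ x ∈ regularPoints β (branchMap β), 1 - δ < x ∧
      ∀ t < N, itinerary β (branchMap β) x t = kneading β t := by
  have := neBot_regular_left hβ
  have h1 := (Filter.eventually_all_finite (Set.finite_lt_nat N)).2 fun t _ =>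
    eventually_itinerary_eq_kneading hβ t
  have h2 : ∀ᶠ x in 𝓝[regularPoints β (branchMap β) ∩ Iio 1] (1 : ℝ), 1 - δ < x :=
    nhdsWithin_le_nhds (lt_mem_nhds (by linarith))
  obtain ⟨x, hx, h3, h4⟩ := (h1.and (h2.and self_mem_nhdsWithin)).exists
  exact ⟨x, h4.1, h3, hx⟩

/-! ### The orbit of the left limit at `1` -/

/-- The left limits at `1` of the iterates of the transformation. -/
noncomputable def leftOrbit (β : ℝ) : ℕ → ℝ
  | 0 => 1
  | n + 1 => kneading β n + 1 - β * leftOrbit β n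

theorem iterate_sub_leftOrbit (hβ : 1 < β) (hx : x ∈ regularPoints β (branchMap β)) {n : ℕ}
    (h : ∀ t < n, itinerary β (branchMap β) x t = kneading β t) :
    (branchMap β)^[n] x - leftOrbit β n = (-β) ^ n * (x - 1) := by
  induction n with
  | zero => simp [leftOrbit]
  | succ n ih =>
    have := ih fun t ht => h t (by omega)
    rw [iterate_succ_regular hβ hx, h n (by omega), leftOrbit, pow_succ,
      show (-β) ^ n * -β * (x - 1) = -β * ((-β) ^ n * (x - 1)) by ring, ← this]
    ring

theorem iterate_lt_leftOrbit (hβ : 1 < β) (hx : x ∈ regularPoints β (branchMap β)) {n : ℕ}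
    (h : ∀ t < n, itinerary β (branchMap β) x t = kneading β t) :
    (Even n → (branchMap β)^[n] x < leftOrbit β n) ∧
      (Odd n → leftOrbit β n < (branchMap β)^[n] x) := by
  have h1 := iterate_sub_leftOrbit hβ hx h
  have h2 := regular_lt_one hx
  have h3 : 0 < β ^ n := by positivity
  constructor
  · intro hn
    rw [hn.neg_pow] at h1
    nlinarith
  · intro hn
    rw [hn.neg_pow] at h1
    nlinarith

theorem leftOrbit_approx (hβ : 1 < β) (n : ℕ) {ε : ℝ} (hε : 0 < ε) :
    ∃ x ∈ regularPoints β (branchMap β),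
      (∀ t < n + 1, itinerary β (branchMap β) x t = kneading β t) ∧
      |β * (branchMap β)^[n] x - β * leftOrbit β n| < ε := by
  have hb : 0 < β ^ (n + 1) := by positivity
  obtain ⟨x, hx, h1, h2⟩ := exists_regular_prefix hβ (n + 1) (div_pos hε hb)
  refine ⟨x, hx, h2, ?_⟩
  have h3 := iterate_sub_leftOrbit hβ hx (n := n) fun t ht => h2 t (by omega)
  have h4 := regular_lt_one hx
  rw [← mul_sub, h3, abs_mul, abs_mul, abs_pow, abs_neg, abs_of_pos (by linarith : 0 < β),
    abs_of_neg (by linarith), ← mul_assoc, ← pow_succ']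
  rw [sub_lt_comm, lt_div_iff₀ hb] at h1
  linarith

/-- A limit of inequalities for regular points, so strictness is lost here; it is regained in
comparisons through `iterate_lt_leftOrbit`. -/
theorem le_mul_leftOrbit (hβ : 1 < β) (n : ℕ) : (kneading β n : ℝ) ≤ β * leftOrbit β n := by
  refine le_of_forall_pos_le_add fun ε hε => ?_
  obtain ⟨x, hx, h1, h2⟩ := leftOrbit_approx hβ n hε
  have h3 := digit_lt_iterate hβ hx n
  rw [h1 n (by omega)] at h3
  linarith [(abs_lt.1 h2).2]

theorem mul_leftOrbit_le (hβ : 1 < β) (n : ℕ) : β * leftOrbit β n ≤ kneading β n + 1 := by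
  refine le_of_forall_pos_le_add fun ε hε => ?_
  obtain ⟨x, hx, h1, h2⟩ := leftOrbit_approx hβ n hε
  have h3 := iterate_lt_digit β x n
  rw [h1 n (by omega)] at h3
  linarith [(abs_lt.1 h2).1]

theorem altLe_itinerary (hβ : 1 < β) (hx : x ∈ regularPoints β (branchMap β)) :
    AltLe (kneading β) (itinerary β (branchMap β) x) := by
  intro n hn
  have h1 := iterate_lt_leftOrbit hβ hx hn
  have hb : 0 < β := by linarith
  constructor
  · intro he
    have h2 := mul_lt_mul_of_pos_left (h1.1 he) hb
    have h3 := digit_lt_iterate hβ hx n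
    have h4 := mul_leftOrbit_le hβ n
    have : (itinerary β (branchMap β) x n : ℝ) < kneading β n + 1 := by linarith
    exact Nat.lt_succ_iff.1 (by exact_mod_cast this)
  · intro he
    have h2 := mul_lt_mul_of_pos_left (h1.2 he) hb
    have h3 := iterate_lt_digit β x n
    have h4 := le_mul_leftOrbit hβ n
    have : (kneading β n : ℝ) < itinerary β (branchMap β) x n + 1 := by linarith
    exact Nat.lt_succ_iff.1 (by exact_mod_cast this)

theorem itinerary_mem_admissible (hβ : 1 < β) (hx : x ∈ regularPoints β (branchMap β)) :
    itinerary β (branchMap β) x ∈ Admissible (kneading β) := by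
  intro k
  have := altLe_itinerary hβ (regular_iterate hβ hx k)
  convert this using 1
  funext t
  rw [itinerary_iterate]

theorem kneading_zero_lt (hβ : 1 < β) : (kneading β 0 : ℝ) < β := by
  obtain ⟨x, hx, -, h⟩ := exists_regular_prefix hβ 1 one_pos
  have h1 := digit_lt_iterate hβ hx 0
  rw [h 0 one_pos] at h1
  have h2 := regular_lt_one hx
  simp only [Function.iterate_zero, id] at h1
  nlinarith

/-! ### The symbolic space consists of the admissible sequences -/

theorem regular_of_digit (hβ : 1 < β) {y : ℝ} (hy : y ∈ regularPoints β (branchMap β)) {d : ℕ}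
    (hd : (d : ℝ) + 1 - y < β) :
    (d + 1 - y) / β ∈ regularPoints β (branchMap β) ∧ ⌊β * ((d + 1 - y) / β)⌋₊ = d ∧
      branchMap β ((d + 1 - y) / β) = y := by
  have hb : 0 < β := by linarith
  have h0 := regular_pos hβ hy
  have h1 := regular_lt_one hy
  have hm : β * ((d + 1 - y) / β) = d + 1 - y := by field_simp
  have hfl : ⌊β * (((d : ℝ) + 1 - y) / β)⌋ = d := by
    rw [hm, Int.floor_eq_iff]; push_cast; constructor <;> linarith
  have hmap : branchMap β ((d + 1 - y) / β) = y := by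
    rw [branchMap, hfl, neg_mul, hm]; push_cast; ring
  have hpos : 0 < ((d : ℝ) + 1 - y) / β :=
    div_pos (by have : (0 : ℝ) ≤ d := Nat.cast_nonneg d
                linarith) hb
  have hlt : ((d : ℝ) + 1 - y) / β < 1 := (div_lt_one hb).2 hd
  refine ⟨⟨⟨hpos.le, hlt.le⟩, fun k => ?_⟩, ?_, hmap⟩
  · cases k with
    | zero =>
      rintro (h | ⟨j, -, h⟩)
      · exact hlt.ne h
      · simp only [Function.iterate_zero, id] at h
        rw [div_left_inj' hb.ne'] at h
        have h2 : (d : ℝ) < j := by linarith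
        have h3 : (j : ℝ) < d + 1 := by linarith
        norm_cast at h2 h3
        omega
    | succ k => rw [Function.iterate_succ_apply, hmap]; exact hy.2 k
  · rw [hm, Nat.floor_eq_iff (by linarith [show (0 : ℝ) ≤ d from Nat.cast_nonneg d])]
    constructor <;> linarith

/-- The point is pulled back one digit at a time. A border `m` that extends to `m + 1` inherits its
inequality, reversed because inverse branches are decreasing; for one that does not extend,
admissibility makes the digit differ strictly on the right side. -/
theorem exists_regular_of_borders (hβ : 1 < β) {ω : ℕ → ℕ} (hω : ω ∈ Admissible (kneading β))
    (n : ℕ) {y : ℝ} (hy : y ∈ regularPoints β (branchMap β))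
    (hb : ∀ m, IsBorder (kneading β) ω n m →
      (Even m → y < leftOrbit β m) ∧ (Odd m → leftOrbit β m < y)) :
    ∃ x ∈ regularPoints β (branchMap β), (∀ t < n, itinerary β (branchMap β) x t = ω t) ∧
      (branchMap β)^[n] x = y := by
  induction n generalizing y with
  | zero => exact ⟨y, hy, by simp, rfl⟩
  | succ n ih =>
    have hβ0 : 0 < β := by linarith
    have h0 := regular_pos hβ hy
    have h1 := regular_lt_one hy
    have hd : (ω n : ℝ) + 1 - y < β := by
      have hk := kneading_zero_lt hβ
      -- Only the top digit has an incomplete branch; for it, the border of length 1 keeps `y` in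
      -- the image of that branch.
      have hle : ω n ≤ kneading β 0 := (hω n 0 (by simp)).1 (by simp)
      rcases hle.lt_or_eq with h | h
      · have : (ω n : ℝ) + 1 ≤ kneading β 0 := by exact_mod_cast h
        linarith
      · have h2 := (hb 1 (isBorder_succ.2 ⟨isBorder_zero, h⟩)).2 odd_one
        simp only [leftOrbit, mul_one] at h2
        rw [h]; linarith
    obtain ⟨hr, hfl, hmap⟩ := regular_of_digit hβ hy hd
    have hm : β * ((ω n + 1 - y) / β) = ω n + 1 - y := by field_simp
    obtain ⟨x, hx, hx1, hx2⟩ := ih hr fun m hbm => by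
      by_cases he : ω n = kneading β m
      · have h2 := hb (m + 1) (isBorder_succ.2 ⟨hbm, he⟩)
        simp only [leftOrbit] at h2
        rw [← he] at h2
        constructor
        · intro hev
          have := h2.2 hev.add_one
          refine lt_of_mul_lt_mul_left (a := β) ?_ hβ0.le
          rw [hm]; linarith
        · intro hod
          have := h2.1 hod.add_one
          refine lt_of_mul_lt_mul_left (a := β) ?_ hβ0.le
          rw [hm]; linarith
      · have h2 := hω (n - m) m hbm.2
        simp only [Nat.sub_add_cancel hbm.1] at h2
        constructor
        · intro hev
          have h3 : ω n + 1 ≤ kneading β m := lt_of_le_of_ne (h2.1 hev) he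
          have h4 : (ω n : ℝ) + 1 ≤ kneading β m := by exact_mod_cast h3
          have h5 := le_mul_leftOrbit hβ m
          refine lt_of_mul_lt_mul_left (a := β) ?_ hβ0.le
          rw [hm]; linarith
        · intro hod
          have h3 : kneading β m + 1 ≤ ω n := lt_of_le_of_ne (h2.2 hod) (Ne.symm he)
          have h4 : (kneading β m : ℝ) + 1 ≤ ω n := by exact_mod_cast h3
          have h5 := mul_leftOrbit_le hβ m
          refine lt_of_mul_lt_mul_left (a := β) ?_ hβ0.le
          rw [hm]; linarith
    refine ⟨x, hx, fun t ht => ?_, ?_⟩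
    · rcases Nat.lt_succ_iff_lt_or_eq.1 ht with h | rfl
      · exact hx1 t h
      · rw [itinerary, hx2, hfl]
    · rw [Function.iterate_succ_apply', hx2, hmap]

theorem exists_regular_itinerary (hβ : 1 < β) {ω : ℕ → ℕ} (hω : ω ∈ Admissible (kneading β))
    (n : ℕ) : ∃ x ∈ regularPoints β (branchMap β), ∀ t < n, itinerary β (branchMap β) x t = ω t := by
  -- The endpoint is an iterate of a regular point whose itinerary starts with the longest border;
  -- each shorter border is then a prefix of a later itinerary, which gives all required
  -- inequalities.
  obtain ⟨x, hx, -, hp⟩ := exists_regular_prefix hβ (border (kneading β) ω n) one_pos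
  obtain ⟨z, hz, hz1, -⟩ := exists_regular_of_borders hβ hω n
    (regular_iterate hβ hx (border (kneading β) ω n)) fun m hm => by
      have hb := (isBorder_iff_of_border _ rfl).1 hm
      have hr := regular_iterate hβ hx (border (kneading β) ω n - m)
      have := iterate_lt_leftOrbit hβ hr (n := m) fun t ht => by
        rw [itinerary_iterate, hp _ (by have := hb.1; omega), hb.2 t ht]
      rwa [← Function.iterate_add_apply, Nat.add_sub_cancel' hb.1] at this
  exact ⟨z, hz, hz1⟩

theorem symbolicSpace_eq_admissible (hβ : 1 < β) :
    symbolicSpace β = Admissible (kneading β) := by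
  ext ω
  rw [symbolicSpace, mem_closure_iff_forall_agree, regularPoints_transformation hβ]
  constructor
  · intro h
    refine admissible_of_forall_exists fun N => ?_
    obtain ⟨_, ⟨x, hx, rfl⟩, he⟩ := h N
    rw [itinerary_transformation hβ hx] at he
    exact ⟨_, itinerary_mem_admissible hβ hx, he⟩
  · intro h N
    obtain ⟨x, hx, he⟩ := exists_regular_itinerary hβ h N
    exact ⟨_, ⟨x, hx, rfl⟩, by rwa [itinerary_transformation hβ hx]⟩

theorem kneading_mem_admissible (hβ : 1 < β) : kneading β ∈ Admissible (kneading β) :=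
  admissible_of_forall_exists fun N => by
    obtain ⟨x, hx, -, h⟩ := exists_regular_prefix hβ N one_pos
    exact ⟨_, itinerary_mem_admissible hβ hx, h⟩

/-- Equal itineraries would keep the two orbits within 1/β of each other, while their distance `β ^
n * (1 - x)` is unbounded. -/
theorem itinerary_ne_kneading (hβ : 1 < β) (hx : x ∈ regularPoints β (branchMap β)) :
    itinerary β (branchMap β) x ≠ kneading β := by
  intro h
  have h1 := regular_lt_one hx
  obtain ⟨n, hn⟩ := pow_unbounded_of_one_lt (1 / (1 - x)) hβ
  rw [div_lt_iff₀ (by linarith)] at hn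
  have h2 := iterate_sub_leftOrbit hβ hx (n := n) fun t _ => congrFun h t
  have h3 := digit_lt_iterate hβ hx n
  have h4 := iterate_lt_digit β x n
  rw [h] at h3 h4
  have h5 := le_mul_leftOrbit hβ n
  have h6 := mul_leftOrbit_le hβ n
  have h7 : |(branchMap β)^[n] x - leftOrbit β n| = β ^ n * (1 - x) := by
    rw [h2, abs_mul, abs_pow, abs_neg, abs_of_pos (by linarith : 0 < β),
      abs_of_neg (by linarith), neg_sub]
  have h8 : β * |(branchMap β)^[n] x - leftOrbit β n| ≤ 1 := by
    rw [← abs_of_pos (by linarith : 0 < β), ← abs_mul, abs_of_pos (by linarith : 0 < β), mul_sub,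
      abs_le]
    constructor <;> linarith
  rw [h7] at h8
  nlinarith

theorem exists_admissible_ne_kneading (hβ : 1 < β) (n : ℕ) :
    ∃ ζ ∈ Admissible (kneading β), (∀ t < n, ζ t = kneading β t) ∧ ζ ≠ kneading β := by
  obtain ⟨x, hx, -, h⟩ := exists_regular_prefix hβ n one_pos
  exact ⟨_, itinerary_mem_admissible hβ hx, h, itinerary_ne_kneading hβ hx⟩

/-! ### The graph of borders -/

/-- There is an edge from the `i`-th to the `j`-th vertex with label `a`, in terms of admissible
sequences. -/
def Step (s : ℕ → ℕ) (i a j : ℕ) : Prop :=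
  ∃ ζ ∈ Admissible s, (∀ t < i, ζ t = s t) ∧ ζ i = a ∧ border s ζ (i + 1) = j

/-- There is a non-trivial path from `i` to `j`. -/
def Reach (s : ℕ → ℕ) : ℕ → ℕ → Prop :=
  Relation.TransGen (fun i j => ∃ a, Step s i a j)

/-- `p` is the vertex sequence of a path with labels `ω`. -/
def IsPath (s p ω : ℕ → ℕ) : Prop :=
  ∀ k, Step s (p k) (ω k) (p (k + 1))

/-- The label sequences of paths in `C`. -/
def labels (s : ℕ → ℕ) (C : Set ℕ) : Set (ℕ → ℕ) :=
  {ω | ∃ p : ℕ → ℕ, (∀ k, p k ∈ C) ∧ IsPath s p ω}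

/-- `C` is an irreducible component. -/
def IsComponent (s : ℕ → ℕ) (C : Set ℕ) : Prop :=
  ∃ i, Reach s i i ∧ C = {j | Reach s i j ∧ Reach s j i}

/-- Every sequence that may follow the vertex `w` may be reached from `z` after `d` letters. -/
def Connects (s : ℕ → ℕ) (z w d : ℕ) : Prop :=
  ∀ y ∈ followers s w, ∃ x ∈ followers s z, ∀ i, x (d + i) = y i

variable {s ζ ω p y : ℕ → ℕ} {n i j a z w d e : ℕ} {C : Set ℕ}

theorem step_of_admissible (hζ : ζ ∈ Admissible s) (n : ℕ) :
    Step s (border s ζ n) (ζ n) (border s ζ (n + 1)) := by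
  have h := shift_mem_followers hζ n
  refine ⟨_, h, fun t ht => splice_of_lt ht, ?_, ?_⟩
  · simpa using splice_add s (fun t => ζ (n + t)) (border s ζ n) 0
  · refine border_succ_eq (border_of_eq fun t ht => splice_of_lt ht) ?_
    simpa using splice_add s (fun t => ζ (n + t)) (border s ζ n) 0

theorem step_forward (hs : s ∈ Admissible s) (i : ℕ) : Step s i (s i) (i + 1) :=
  ⟨s, hs, fun _ _ => rfl, rfl, border_of_eq fun _ _ => rfl⟩

theorem Step.border_succ (h : Step s i a j) (hi : border s ζ n = i) (ha : ζ n = a) :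
    border s ζ (n + 1) = j := by
  obtain ⟨ζ', -, h1, h2, rfl⟩ := h
  exact border_succ_eq (hi.trans (border_of_eq h1).symm) (ha.trans h2.symm)

theorem Step.splice_mem (hs : s ∈ Admissible s) (h : Step s i a j) (hy : y ∈ followers s j) :
    splice (fun _ => a) 1 y ∈ followers s i := by
  obtain ⟨ζ, hζ, h1, h2, rfl⟩ := h
  suffices e : splice s i (splice (fun _ => a) 1 y) = splice ζ (i + 1) y by
    rw [followers, mem_ofPred_eq, e]
    exact admissible_splice hζ hy hs
  funext t
  rcases lt_trichotomy t i with ht | rfl | ht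
  · rw [splice_of_lt ht, splice_of_lt (by omega), h1 t ht]
  · rw [splice_of_lt (Nat.lt_succ_self t), h2]
    exact splice_add s (splice (fun _ => a) 1 y) t 0
  · obtain ⟨r, rfl⟩ := Nat.exists_eq_add_of_le (Nat.succ_le_of_lt ht)
    rw [splice_add, show i.succ + r = i + (1 + r) by omega, splice_add, splice_add]

theorem exists_step_of_mem_followers (h : y ∈ followers s i) :
    ∃ j, Step s i (y 0) j :=
  ⟨_, _, h, fun _ ht => splice_of_lt ht, splice_add s y i 0, rfl⟩

theorem Step.exists_mem_followers (h : Step s i a j) : ∃ y ∈ followers s i, y 0 = a := by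
  obtain ⟨ζ, hζ, h1, h2, -⟩ := h
  have := shift_mem_followers hζ i
  rw [border_of_eq h1] at this
  exact ⟨_, this, h2⟩

theorem self_mem_followers (hs : s ∈ Admissible s) (i : ℕ) :
    (fun t => s (i + t)) ∈ followers s i := by
  have := shift_mem_followers hs i
  rwa [border_of_eq fun _ _ => rfl] at this

/-! ### Paths -/

theorem IsPath.tail (h : IsPath s p ω) (n : ℕ) :
    IsPath s (fun k => p (n + k)) (fun k => ω (n + k)) := fun k => h (n + k)

theorem isPath_border (hζ : ζ ∈ Admissible s) (n : ℕ) :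
    IsPath s (fun k => border s ζ (n + k)) (fun k => ζ (n + k)) :=
  fun k => step_of_admissible hζ (n + k)

theorem isPath_of_mem_followers (h : ω ∈ followers s i) :
    IsPath s (fun k => border s (splice s i ω) (i + k)) ω := by
  have := isPath_border h i
  simpa only [splice_add] using this

/-- Determinism of the graph: the start vertex and the labels fix the whole path. -/
theorem IsPath.eq_border (h : IsPath s p ω) (k : ℕ) :
    p k = border s (splice s (p 0) ω) (p 0 + k) := by
  induction k with
  | zero => exact (border_of_eq fun t ht => splice_of_lt ht).symm
  | succ k ih => exact ((h k).border_succ ih.symm (splice_add _ _ _ _)).symm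

theorem IsPath.splice_mem (hs : s ∈ Admissible s) (h : IsPath s p ω) (n : ℕ)
    (hy : y ∈ followers s (p n)) : splice ω n y ∈ followers s (p 0) := by
  induction n generalizing y with
  | zero => convert hy using 1; funext t; simp [splice]
  | succ n ih =>
    convert ih ((h n).splice_mem hs hy) using 1
    funext t
    rcases lt_trichotomy t n with ht | rfl | ht
    · rw [splice_of_lt ht, splice_of_lt (by omega)]
    · rw [splice_of_lt (Nat.lt_succ_self t)]
      exact (splice_add ω (splice (fun _ => ω t) 1 y) t 0).symm
    · obtain ⟨r, rfl⟩ := Nat.exists_eq_add_of_le (Nat.succ_le_of_lt ht)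
      rw [splice_add, show n.succ + r = n + (1 + r) by omega, splice_add, splice_add]

theorem IsPath.mem_followers (hs : s ∈ Admissible s) (h : IsPath s p ω) :
    ω ∈ followers s (p 0) := by
  -- Any finite piece of the path can be continued along the spine, and admissibility is a closed
  -- condition.
  refine admissible_of_forall_exists fun N =>
    ⟨_, h.splice_mem hs N (self_mem_followers hs (p N)), fun t ht => ?_⟩
  by_cases htp : t < p 0
  · rw [splice_of_lt htp, splice_of_lt htp]
  · obtain ⟨r, rfl⟩ := Nat.exists_eq_add_of_le (not_lt.1 htp)
    rw [splice_add, splice_add, splice_of_lt (by omega)]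

theorem labels_univ (hs : s ∈ Admissible s) : labels s univ = Admissible s := by
  ext ω
  constructor
  · rintro ⟨p, -, hp⟩
    exact mem_admissible_of_mem_followers (hp.mem_followers hs)
  · intro h
    exact ⟨_, fun _ => mem_univ _, isPath_of_mem_followers (mem_followers_zero.2 h)⟩

theorem labels_subset (hs : s ∈ Admissible s) (C : Set ℕ) : labels s C ⊆ Admissible s := by
  rintro ω ⟨p, -, hp⟩
  exact mem_admissible_of_mem_followers (hp.mem_followers hs)

theorem labels_shift (h : ω ∈ labels s C) (n : ℕ) : (fun t => ω (n + t)) ∈ labels s C := by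
  obtain ⟨p, h1, h2⟩ := h
  exact ⟨_, fun k => h1 (n + k), h2.tail n⟩

/-! ### Reachability -/

theorem Step.reach (h : Step s i a j) : Reach s i j := Relation.TransGen.single ⟨a, h⟩

theorem Reach.trans (h : Reach s i j) (h' : Reach s j w) : Reach s i w :=
  Relation.TransGen.trans h h'

theorem reach_of_lt (hs : s ∈ Admissible s) (h : i < j) : Reach s i j := by
  induction j, h using Nat.le_induction with
  | base => exact (step_forward hs i).reach
  | succ j _ ih => exact ih.trans (step_forward hs j).reach

theorem Reach.trans_le (hs : s ∈ Admissible s) (h : Reach s i j) (hj : j ≤ w) : Reach s i w := by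
  rcases hj.lt_or_eq with h' | rfl
  · exact h.trans (reach_of_lt hs h')
  · exact h

theorem reach_of_le_of_reach (hs : s ∈ Admissible s) (h : Reach s j w) (hj : i ≤ j) :
    Reach s i w := by
  rcases hj.lt_or_eq with h' | rfl
  · exact (reach_of_lt hs h').trans h
  · exact h

theorem IsPath.reach_of_lt (h : IsPath s p ω) (hij : i < j) : Reach s (p i) (p j) := by
  induction j, hij using Nat.le_induction with
  | base => exact (h i).reach
  | succ j _ ih => exact ih.trans (h j).reach

theorem connects_refl (s : ℕ → ℕ) (z : ℕ) : Connects s z z 0 :=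
  fun y hy => ⟨y, hy, fun i => by rw [zero_add]⟩

theorem Connects.trans {k : ℕ} (h : Connects s z w d) (h' : Connects s w k e) :
    Connects s z k (d + e) := by
  intro y hy
  obtain ⟨x, hx, h1⟩ := h' y hy
  obtain ⟨x', hx', h2⟩ := h x hx
  exact ⟨x', hx', fun i => by rw [add_assoc, h2, h1]⟩

theorem Step.connects (hs : s ∈ Admissible s) (h : Step s i a j) : Connects s i j 1 :=
  fun y hy => ⟨_, h.splice_mem hs hy, fun i => splice_add _ y 1 i⟩

theorem Reach.exists_connects (hs : s ∈ Admissible s) (h : Reach s i j) :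
    ∃ d, Connects s i j d := by
  induction h with
  | single h => obtain ⟨a, h⟩ := h; exact ⟨1, h.connects hs⟩
  | tail _ h ih =>
    obtain ⟨a, h⟩ := h
    obtain ⟨d, hd⟩ := ih
    exact ⟨_, hd.trans (h.connects hs)⟩

theorem connects_forward (hs : s ∈ Admissible s) (z d : ℕ) : Connects s z (z + d) d := by
  induction d with
  | zero => exact connects_refl s z
  | succ d ih => exact ih.trans ((step_forward hs (z + d)).connects hs)

/-! ### Components -/

theorem IsComponent.reach (h : IsComponent s C) (hi : i ∈ C) (hj : j ∈ C) : Reach s i j := by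
  obtain ⟨r, -, rfl⟩ := h
  exact hi.2.trans hj.1

theorem IsComponent.mem_of_reach (h : IsComponent s C) (hi : i ∈ C) (hj : j ∈ C)
    (h1 : Reach s i w) (h2 : Reach s w j) : w ∈ C := by
  obtain ⟨r, -, rfl⟩ := h
  exact ⟨hi.1.trans h1, h2.trans hj.2⟩

theorem IsPath.mem_component (h : IsPath s p ω) (hC : IsComponent s C) {k : ℕ}
    (hi : p i ∈ C) (hj : p j ∈ C) (hik : i ≤ k) (hkj : k ≤ j) : p k ∈ C := by
  rcases hik.lt_or_eq with h1 | rfl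
  · rcases hkj.lt_or_eq with h2 | rfl
    · exact hC.mem_of_reach hi hj (h.reach_of_lt h1) (h.reach_of_lt h2)
    · exact hj
  · exact hi

/-! ### Eventually periodic kneading sequences -/

/-- `s` is an admissible sequence with even eventual period `v` from the index `u` on, which is not
isolated in the space of admissible sequences. -/
structure IsKneadingBound (s : ℕ → ℕ) (u v : ℕ) : Prop where
  self_mem : s ∈ Admissible s
  pos : 0 < v
  even : Even v
  period : ∀ k, u ≤ k → s (k + v) = s k
  not_isolated : ∀ n, ∃ ζ ∈ Admissible s, (∀ t < n, ζ t = s t) ∧ ζ ≠ s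

variable {u v : ℕ}

namespace IsKneadingBound

/-- A longer border would, without its last letter, overlap `s` in at least `u + v` letters. Then
`s` equals its shift, and the last letter would have to be `s i`. -/
theorem step_le (h : IsKneadingBound s u v) (hst : Step s i a j) (ha : a ≠ s i) : j ≤ u + v := by
  obtain ⟨ζ, hζ, h1, h2, rfl⟩ := hst
  by_contra! hlt
  obtain ⟨l, hl⟩ : ∃ l, border s ζ (i + 1) = l + 1 := ⟨border s ζ (i + 1) - 1, by omega⟩
  have hb := isBorder_border s ζ (i + 1)
  rw [hl, isBorder_succ] at hb
  have hb' := (isBorder_iff_of_border i (border_of_eq h1)).1 hb.1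
  have := isBorder_self_eq_shift h.period h.pos hb' (by omega) l
  rw [Nat.sub_add_cancel hb'.1, ← hb.2, h2] at this
  exact ha this

theorem exists_branch (h : IsKneadingBound s u v) (n : ℕ) :
    ∃ i ≥ n, ∃ a ≠ s i, ∃ j, Step s i a j := by
  classical
  obtain ⟨ζ, hζ, h1, h2⟩ := h.not_isolated n
  have hex : ∃ t, ζ t ≠ s t := Function.ne_iff.1 h2
  refine ⟨Nat.find hex, ?_, _, Nat.find_spec hex, _, ζ, hζ, fun t ht => ?_, rfl, rfl⟩
  · by_contra! hlt
    exact Nat.find_spec hex (h1 _ hlt)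
  · by_contra hne
    exact Nat.find_min hex ht hne

/-- Branches occur somewhere beyond `z`; a first one at distance at least `v` could be moved back by
`v`, since the followers and `s` are periodic there. -/
theorem exists_branch_near (h : IsKneadingBound s u v) (hz : 2 * u + 2 * v ≤ z) :
    ∃ d < v, ∃ a ≠ s (z + d), ∃ j, Step s (z + d) a j := by
  classical
  have hex : ∃ d, ∃ a ≠ s (z + d), ∃ j, Step s (z + d) a j := by
    obtain ⟨i, hi, hb⟩ := h.exists_branch z
    obtain ⟨d, rfl⟩ := Nat.exists_eq_add_of_le hi
    exact ⟨d, hb⟩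
  refine ⟨Nat.find hex, ?_, Nat.find_spec hex⟩
  by_contra! hle
  obtain ⟨r, hr⟩ := Nat.exists_eq_add_of_le' hle
  obtain ⟨a, ha, j, hj⟩ := Nat.find_spec hex
  refine Nat.find_min hex (m := r) (by have := h.pos; omega) ?_
  rw [hr, ← add_assoc] at hj ha
  obtain ⟨y, hy, rfl⟩ := hj.exists_mem_followers
  rw [followers_add_period h.self_mem h.pos h.even h.period (by omega)] at hy
  rw [h.period _ (by omega)] at ha
  exact ⟨_, ha, exists_step_of_mem_followers hy⟩

theorem reach_back (h : IsKneadingBound s u v) (z : ℕ) : Reach s z (u + v) := by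
  obtain ⟨i, hi, a, ha, j, hj⟩ := h.exists_branch z
  exact reach_of_le_of_reach h.self_mem (hj.reach.trans_le h.self_mem (h.step_le hj ha)) hi

theorem reach_top (h : IsKneadingBound s u v) (hz : u + v ≤ z) : Reach s (u + v) z :=
  (h.reach_back _).trans_le h.self_mem hz

end IsKneadingBound

/-- The last component. -/
def topComponent (s : ℕ → ℕ) (u v : ℕ) : Set ℕ := {j | Reach s (u + v) j}

namespace IsKneadingBound

theorem isComponent_top (h : IsKneadingBound s u v) : IsComponent s (topComponent s u v) := by
  refine ⟨u + v, h.reach_back _, ?_⟩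
  ext j
  exact ⟨fun hj => ⟨hj, h.reach_back j⟩, fun hj => hj.1⟩

theorem eq_top (h : IsKneadingBound s u v) (hC : IsComponent s C) (hi : i ∈ C)
    (hi' : i ∈ topComponent s u v) : C = topComponent s u v := by
  ext j
  exact ⟨fun hj => Reach.trans hi' (hC.reach hi hj),
    fun hj => hC.mem_of_reach hi hi ((h.reach_back i).trans hj) ((h.reach_back j).trans hi')⟩

theorem mem_top_of_isPath (h : IsPath s p ω) (hi : p i ∈ topComponent s u v) (hij : i ≤ j) :
    p j ∈ topComponent s u v := by
  rcases hij.lt_or_eq with h' | rfl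
  · exact Reach.trans hi (h.reach_of_lt h')
  · exact hi

theorem shift_mem_labels_top (hζ : ζ ∈ Admissible s)
    (hn : border s ζ n ∈ topComponent s u v) :
    (fun t => ζ (n + t)) ∈ labels s (topComponent s u v) :=
  ⟨_, fun k => mem_top_of_isPath (isPath_border hζ n) (i := 0) hn (Nat.zero_le k),
    isPath_border hζ n⟩

/-- If two letters are possible after an initial word of `s`, then the larger one may be followed
by `s` itself. -/
theorem splice_branch_mem (hs : s ∈ Admissible s) {b j' : ℕ} (h1 : Step s i a j)
    (h2 : Step s i b j') (hab : a < b) : splice (fun _ => b) 1 s ∈ followers s i := by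
  have hlow : ∀ m, IsBorder s s i m → Odd m → s m ≤ a := by
    intro m hm hod
    obtain ⟨ζ, hζ, e1, e2, -⟩ := h1
    have hb := (isBorder_iff_of_border i (border_of_eq e1)).2 hm
    have := (hζ (i - m) m hb.2).2 hod
    dsimp only at this
    rwa [Nat.sub_add_cancel hm.1, e2] at this
  have hhigh : ∀ m, IsBorder s s i m → Even m → b ≤ s m := by
    intro m hm hev
    obtain ⟨ζ, hζ, e1, e2, -⟩ := h2
    have hb := (isBorder_iff_of_border i (border_of_eq e1)).2 hm
    have := (hζ (i - m) m hb.2).1 hev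
    dsimp only at this
    rwa [Nat.sub_add_cancel hm.1, e2] at this
  -- The smaller letter rules out `b = s m` for odd `m`. A tie occurs only for even `m`; then `s` is
  -- compared from the odd index `m + 1` on, where the order is reversed, and the requirement is
  -- admissibility of `s` itself.
  have key : ∀ m, IsBorder s s i m → AltLe s (splice s m (splice (fun _ => b) 1 s)) := by
    intro m hm
    rw [altLe_splice_iff]
    intro n hn
    cases n with
    | zero =>
      simp only [splice, add_zero, Nat.lt_one_iff, if_true]
      exact ⟨hhigh m hm, fun hod => (hlow m hm hod).trans hab.le⟩
    | succ n =>
      have hb : b = s m := by simpa [splice] using hn 0 (by omega)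
      have hev : Even m := by
        by_contra hod
        have := hlow m hm (Nat.not_even_iff_odd.1 hod)
        omega
      have hn' : ∀ t < n, s (m + 1 + t) = s t := fun t ht => by
        have := hn (1 + t) (by omega)
        rw [splice_add] at this
        rw [this]; congr 1; omega
      have := hs (m + 1) n hn'
      rw [show n + 1 = 1 + n by omega, splice_add, ← add_assoc]
      have e1 : Even (m + 1 + n) ↔ Odd n := by
        rw [Nat.even_add, Nat.even_add_one, ← Nat.not_even_iff_odd]; simp [hev]
      have e2 : Odd (m + 1 + n) ↔ Even n := by
        rw [← Nat.not_even_iff_odd, e1, Nat.not_odd_iff_even]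
      rw [e1, e2]
      exact ⟨this.2, this.1⟩
  refine (mem_admissible_splice_iff hs).2 ⟨?_, key⟩
  intro k
  cases k with
  | zero =>
    have := key 0 isBorder_zero
    have e : splice s 0 (splice (fun _ => b) 1 s) =
        fun t => splice (fun _ => b) 1 s (0 + t) := by
      funext t
      have := splice_add s (splice (fun _ => b) 1 s) 0 t
      rwa [zero_add] at this ⊢
    rwa [e] at this
  | succ k =>
    have := hs k
    convert this using 1
    funext t
    rw [show k + 1 + t = 1 + (k + t) by omega, splice_add]

/-- The path reading `s` from vertex 0 may begin outside the last component. Instead `s` is read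
after the larger letter at a branching vertex already in that component. -/
theorem tail_mem_labels_top (h : IsKneadingBound s u v) (c : ℕ) :
    (fun t => s (c + t)) ∈ labels s (topComponent s u v) := by
  obtain ⟨i, hi, a, ha, j, hj⟩ := h.exists_branch (u + v)
  obtain ⟨b, hb⟩ : ∃ b, splice (fun _ => b) 1 s ∈ followers s i := by
    rcases lt_or_gt_of_ne ha with hlt | hlt
    · exact ⟨_, splice_branch_mem h.self_mem hj (step_forward h.self_mem i) hlt⟩
    · exact ⟨_, splice_branch_mem h.self_mem (step_forward h.self_mem i) hj hlt⟩
  have h1 : border s (splice s i (splice (fun _ => b) 1 s)) i = i :=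
    border_of_eq fun t ht => splice_of_lt ht
  have h2 := shift_mem_labels_top hb (n := i) (by rw [h1]; exact h.reach_top hi)
  simp only [splice_add] at h2
  have h3 := labels_shift h2 (1 + c)
  simpa only [add_assoc, splice_add] using h3

/-- Paths in a component may be assumed to start at a vertex of bounded index. -/
theorem exists_path_start_le (h : IsKneadingBound s u v) (hC : IsComponent s C)
    (hω : ω ∈ labels s C) :
    ∃ p, (∀ k, p k ∈ C) ∧ IsPath s p ω ∧ p 0 ≤ 2 * u + 3 * v := by
  obtain ⟨p, hp, hpath⟩ := hω
  generalize hr : p 0 = r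
  induction r using Nat.strong_induction_on generalizing p with
  | _ r ih =>
    by_cases hle : r ≤ 2 * u + 3 * v
    · exact ⟨p, hp, hpath, by omega⟩
    -- Here `r'` still exceeds `2 * u + 2 * v`, so it has the same followers and the same labels can
    -- be read from it; both starts lie in the last component.
    · obtain ⟨r', rfl⟩ : ∃ r', r = r' + v := ⟨r - v, by omega⟩
      have hf := hpath.mem_followers h.self_mem
      rw [hr, followers_add_period h.self_mem h.pos h.even h.period (by omega)] at hf
      have hpath' := isPath_of_mem_followers hf
      have h0 : border s (splice s r' ω) (r' + 0) = r' :=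
        border_of_eq fun t ht => splice_of_lt ht
      have hCt := h.eq_top hC (hp 0) (by rw [hr]; exact h.reach_top (by omega))
      refine ih r' (by have := h.pos; omega) _ (fun k => ?_) hpath' h0
      rw [hCt]
      have h0' : border s (splice s r' ω) (r' + 0) ∈ topComponent s u v := by
        rw [h0]; exact h.reach_top (by omega)
      exact mem_top_of_isPath (p := fun k => border s (splice s r' ω) (r' + k)) hpath' h0'
        (Nat.zero_le k)

/-! ### Closedness of the component subshifts -/

theorem exists_forall_of_forall_exists_le {P : ℕ → ℕ → Prop}
    (hP : ∀ i N N', N ≤ N' → P i N' → P i N) (B : ℕ) (h : ∀ N, ∃ i ≤ B, P i N) : ∃ i ≤ B, ∀ N, P i N := by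
  by_contra! hcon
  have : ∀ i, ∃ N, i ≤ B → ¬ P i N := fun i => by
    by_cases hi : i ≤ B
    · obtain ⟨N, hN⟩ := hcon i hi; exact ⟨N, fun _ => hN⟩
    · exact ⟨0, fun h => absurd h hi⟩
  choose f hf using this
  obtain ⟨i, hi, hPi⟩ := h ((Finset.range (B + 1)).sup f)
  exact hf i hi (hP i _ _ (Finset.le_sup (Finset.mem_range.2 (by omega))) hPi)

/-- By pigeonhole one bounded start vertex serves all `N`. By determinism the approximating paths
agree on common prefixes, so they converge to a path for `ω` in `C`. -/
theorem mem_labels_of_forall_exists (h : IsKneadingBound s u v) (hC : IsComponent s C)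
    (hω : ∀ N, ∃ η ∈ labels s C, ∀ t < N, η t = ω t) : ω ∈ labels s C := by
  obtain ⟨r, -, hr⟩ := exists_forall_of_forall_exists_le
    (P := fun r N => ∃ p η, (∀ k, p k ∈ C) ∧ IsPath s p η ∧ p 0 = r ∧ ∀ t < N, η t = ω t)
    (fun i N N' hN => by
      rintro ⟨p, η, h1, h2, h3, h4⟩
      exact ⟨p, η, h1, h2, h3, fun t ht => h4 t (by omega)⟩)
    (2 * u + 3 * v) (fun N => by
      obtain ⟨η, hη, he⟩ := hω N
      obtain ⟨p, h1, h2, h3⟩ := h.exists_path_start_le hC hη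
      exact ⟨_, h3, p, η, h1, h2, rfl, he⟩)
  have key : ∀ p η N, IsPath s p η → p 0 = r → (∀ t < N, η t = ω t) → ∀ k ≤ N,
      p k = border s (splice s r ω) (r + k) := by
    intro p η N h1 h2 h3 k hk
    rw [h1.eq_border, h2]
    refine border_congr fun t ht => ?_
    by_cases htr : t < r
    · rw [splice_of_lt htr, splice_of_lt htr]
    · obtain ⟨q, rfl⟩ := Nat.exists_eq_add_of_le (not_lt.1 htr)
      rw [splice_add, splice_add, h3 q (by omega)]
  refine ⟨fun k => border s (splice s r ω) (r + k), fun k => ?_, fun k => ?_⟩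
  · obtain ⟨p, η, h1, h2, h3, h4⟩ := hr k
    have := h1 k
    rwa [key p η k h2 h3 h4 k le_rfl] at this
  · obtain ⟨p, η, h1, h2, h3, h4⟩ := hr (k + 1)
    have := h2 k
    rwa [key p η _ h2 h3 h4 k (by omega), key p η _ h2 h3 h4 (k + 1) le_rfl,
      h4 k (by omega)] at this

/-! ### Recurrence -/

theorem exists_component_eventually (h : IsKneadingBound s u v) (hω : ω ∈ Admissible s) :
    ∃ K C, IsComponent s C ∧ ∀ k ≥ K, border s ω k ∈ C := by
  have hp : IsPath s (border s ω) ω := fun k => step_of_admissible hω k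
  -- Either the path enters the last component, which it cannot leave, or its indices are bounded
  -- and some vertex is visited infinitely often.
  by_cases hK : ∃ K, u + v ≤ border s ω K
  · obtain ⟨K, hK⟩ := hK
    exact ⟨K, _, h.isComponent_top, fun k hk => mem_top_of_isPath hp (h.reach_top hK) hk⟩
  · push Not at hK
    obtain ⟨r, -, hr⟩ := exists_forall_of_forall_exists_le
      (P := fun r N => ∃ k ≥ N, border s ω k = r)
      (fun i N N' hN ⟨k, h1, h2⟩ => ⟨k, by omega, h2⟩) (u + v)
      (fun N => ⟨_, (hK N).le, N, le_rfl, rfl⟩)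
    obtain ⟨K, -, hKr⟩ := hr 0
    have hback : ∀ k, Reach s (border s ω k) r := fun k => by
      obtain ⟨k', h1, h2⟩ := hr (k + 1)
      rw [← h2]; exact hp.reach_of_lt h1
    refine ⟨K + 1, _, ⟨r, hKr ▸ hback K, rfl⟩, fun k hk => ⟨?_, hback k⟩⟩
    rw [← hKr]; exact hp.reach_of_lt hk

theorem exists_component_of_returns (h : IsKneadingBound s u v) (hω : ω ∈ Admissible s)
    (hret : ∀ N, ∃ n ≥ N, ∃ η ∈ Admissible s, (∀ t < N, η t = ω t) ∧
      ∀ t < N, η (n + t) = ω t) : ∃ C, IsComponent s C ∧ ω ∈ labels s C := by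
  obtain ⟨K, C, hC, hK⟩ := h.exists_component_eventually hω
  -- A border of length at most `N` at time `n + N` sees only the returned copy of `ω`, so it is the
  -- vertex of `ω` at time `N`. The path of `η` thus leaves `C` at no time between `N` and `n + N`;
  -- its piece from `n` on is joined to the tail of the path of `ω`.
  by_cases hcase : ∃ N ≥ K, ∃ n ≥ N, ∃ η ∈ Admissible s, (∀ t < N, η t = ω t) ∧
      (∀ t < N, η (n + t) = ω t) ∧ border s η (n + N) ≤ N
  · obtain ⟨N, hN, n, hn, η, hη, h1, h2, h3⟩ := hcase
    have e1 : border s η (n + N) = border s ω N := by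
      rw [border_shift_of_le h3]; exact border_congr h2
    have hp : IsPath s (border s η) η := fun k => step_of_admissible hη k
    have hmem : ∀ k ≤ N, border s η (n + k) ∈ C := fun k hk =>
      hp.mem_component hC (i := N) (j := n + N)
        (by rw [border_congr h1]; exact hK N hN) (by rw [e1]; exact hK N hN)
        (by omega) (by omega)
    refine ⟨C, hC, fun k => if k ≤ N then border s η (n + k) else border s ω k, fun k => ?_,
      fun k => ?_⟩
    · dsimp only
      split_ifs with hk
      · exact hmem k hk
      · exact hK k (by omega)
    · dsimp only
      rcases lt_trichotomy k N with hk | rfl | hk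
      · rw [if_pos hk.le, if_pos (by omega), ← h2 k hk]
        exact hp (n + k)
      · rw [if_pos le_rfl, if_neg (by omega), e1]
        exact step_of_admissible hω k
      · rw [if_neg (by omega), if_neg (by omega)]
        exact step_of_admissible hω k
  · refine ⟨_, h.isComponent_top, h.mem_labels_of_forall_exists h.isComponent_top fun N => ?_⟩
    obtain ⟨n, hn, η, hη, h1, h2⟩ := hret (max N K)
    have h3 : max N K < border s η (n + max N K) := by
      by_contra! hle
      exact hcase ⟨_, le_max_right N K, n, hn, η, hη, h1, h2, hle⟩
    obtain ⟨c, hc⟩ := Nat.exists_eq_add_of_lt h3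
    by_cases htop : u + v ≤ border s η n
    · exact ⟨_, shift_mem_labels_top hη (h.reach_top htop), fun t ht =>
        h2 t (lt_of_lt_of_le ht (le_max_left _ _))⟩
    -- The border is longer than the returned window, so the window is a subword of `s` starting at
    -- index `c + 1`.
    · refine ⟨_, h.tail_mem_labels_top (c + 1), fun t ht => ?_⟩
      have ht' : t < max N K := lt_of_lt_of_le ht (le_max_left _ _)
      have hb := isBorder_border s η (n + max N K)
      rw [← h2 t ht', ← hb.2 (c + 1 + t) (by omega)]
      congr 1
      have := hb.1
      omega

theorem exists_return (h : IsKneadingBound s u v) (hC : IsComponent s C) (hω : ω ∈ labels s C)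
    (N : ℕ) : ∃ n > 0, ∃ η ∈ Admissible s, (∀ t < N, η t = ω t) ∧ ∀ t, η (n + t) = ω t := by
  obtain ⟨p, h1, h2⟩ := hω
  -- `η` reads `N + 1` letters of `ω`, then a connecting word back to the start vertex, then `ω`
  -- again; the extra letter forces a positive return time.
  obtain ⟨d, hd⟩ := (hC.reach (h1 (N + 1)) (h1 0)).exists_connects h.self_mem
  obtain ⟨x, hx, hxd⟩ := hd ω (h2.mem_followers h.self_mem)
  refine ⟨N + 1 + d, by omega, _,
    mem_admissible_of_mem_followers (h2.splice_mem h.self_mem (N + 1) hx), fun t ht => ?_,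
    fun t => ?_⟩
  · exact splice_of_lt (by omega)
  · rw [add_assoc, splice_add, hxd]

end IsKneadingBound

/-- Recurrence of the initial words of `ω` implies recurrence after arbitrarily large times. -/
theorem exists_large_return {S : Set (ℕ → ℕ)} (hω : ω ∈ S)
    (h : ∀ N, ∃ n > 0, ∃ η ∈ S, (∀ t < N, η t = ω t) ∧ ∀ t < N, η (n + t) = ω t) (N : ℕ) :
    ∃ n ≥ N, ∃ η ∈ S, (∀ t < N, η t = ω t) ∧ ∀ t < N, η (n + t) = ω t := by
  by_cases hper : ∃ q > 0, ∀ t, ω (q + t) = ω t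
  · obtain ⟨q, hq, hqt⟩ := hper
    refine ⟨N * q, Nat.le_mul_of_pos_right N hq, ω, hω, fun _ _ => rfl, fun t _ => ?_⟩
    clear * - hqt
    induction N with
    | zero => simp
    | succ N ih => rw [add_mul, one_mul, add_comm (N * q), add_assoc, hqt, ih]
  · push Not at hper
    have : ∀ q, ∃ t, 0 < q → ω (q + t) ≠ ω t := fun q => by
      by_cases hq : 0 < q
      · obtain ⟨t, ht⟩ := hper q hq; exact ⟨t, fun _ => ht⟩
      · exact ⟨0, fun h => absurd h hq⟩
    choose f hf using this
    -- The longer window contains, for each positive `q < N`, a place where `ω` and its shift by `q`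
    -- differ; this excludes return times below `N`.
    obtain ⟨n, hn, η, hη, h1, h2⟩ := h (N + ((Finset.range N).sup f + 1))
    refine ⟨n, ?_, η, hη, fun t ht => h1 t (by omega), fun t ht => h2 t (by omega)⟩
    by_contra! hlt
    have hle : f n ≤ (Finset.range N).sup f := Finset.le_sup (Finset.mem_range.2 hlt)
    exact hf n hn (by rw [← h1 (n + f n) (by omega), h2 (f n) (by omega)])

namespace IsKneadingBound

/-! ### Specification -/

/-- Sources and targets of bounded index form finitely many pairs. A source further out first
follows the spine for fewer than `v` steps to a branch, which drops it to index at most `u + v`. -/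
theorem exists_connects_le (h : IsKneadingBound s u v) :
    ∃ M, ∀ z w, w ≤ 2 * u + 3 * v → Reach s z w → ∃ d ≤ M, Connects s z w d := by
  have : ∀ q : ℕ × ℕ, ∃ d, Reach s q.1 q.2 → Connects s q.1 q.2 d := fun q => by
    by_cases hq : Reach s q.1 q.2
    · obtain ⟨d, hd⟩ := hq.exists_connects h.self_mem; exact ⟨d, fun _ => hd⟩
    · exact ⟨0, fun h => absurd h hq⟩
  choose f hf using this
  set S := Finset.range (2 * u + 3 * v + 1) ×ˢ Finset.range (2 * u + 3 * v + 1)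
  have hle : ∀ z w, z ≤ 2 * u + 3 * v → w ≤ 2 * u + 3 * v → f (z, w) ≤ S.sup f :=
    fun z w hz hw => Finset.le_sup (Finset.mem_product.2
      ⟨Finset.mem_range.2 (by dsimp only; omega), Finset.mem_range.2 (by dsimp only; omega)⟩)
  refine ⟨v + 1 + S.sup f, fun z w hw hr => ?_⟩
  by_cases hz : z ≤ 2 * u + 3 * v
  · exact ⟨_, (hle z w hz hw).trans (by omega), hf (z, w) hr⟩
  · obtain ⟨d, hd, a, ha, j, hj⟩ := h.exists_branch_near (z := z) (by omega)
    have hjle := h.step_le hj ha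
    have hjw : Reach s j w := (h.reach_back j).trans ((h.reach_top (z := z) (by omega)).trans hr)
    refine ⟨d + 1 + f (j, w), ?_,
      ((connects_forward h.self_mem z d).trans (hj.connects h.self_mem)).trans (hf (j, w) hjw)⟩
    have := hle j w (by omega) hw
    omega

/-- Induction from the last segment backwards. Each segment is copied with `N` extra letters, as
closeness at its last time needs `N` letters of agreement; these and the connecting word form the
gap. -/
theorem exists_shadowing_path (hs : s ∈ Admissible s) {M B N : ℕ}
    (hM : ∀ z w, w ≤ B → Reach s z w → ∃ d ≤ M, Connects s z w d) (k : ℕ)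
    (x p : ℕ → ℕ → ℕ) (n : ℕ → ℕ) (hp : ∀ j, IsPath s (p j) (x j)) (hB : ∀ j, p j 0 ≤ B)
    (hr : ∀ j l, Reach s (p j l) (p (j + 1) 0)) :
    ∃ y ∈ followers s (p 0 0), ∃ m : ℕ → ℕ, (∀ j, m j ≤ N + M) ∧ ∀ j < k, ∀ i < n j + N,
      y (∑ t ∈ Finset.range j, (n t + m t) + i) = x j i := by
  induction k generalizing x p n with
  | zero => exact ⟨x 0, (hp 0).mem_followers hs, fun _ => 0, by simp, by simp⟩
  | succ k ih =>
    obtain ⟨y', hy', m', hm', hsh⟩ := ih (fun j => x (j + 1)) (fun j => p (j + 1))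
      (fun j => n (j + 1)) (fun j => hp _) (fun j => hB _) (fun j l => hr _ l)
    obtain ⟨d, hd, hcon⟩ := hM _ _ (hB 1) (hr 0 (n 0 + N))
    obtain ⟨x', hx', he⟩ := hcon y' hy'
    refine ⟨_, (hp 0).splice_mem hs (n 0 + N) hx', fun j => Nat.casesOn j (N + d) m',
      fun j => ?_, fun j hj i hi => ?_⟩
    · cases j with
      | zero => exact Nat.add_le_add_left hd N
      | succ j => exact hm' j
    · cases j with
      | zero =>
        rw [Finset.range_zero, Finset.sum_empty, zero_add]
        exact splice_of_lt hi
      | succ j =>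
        have := hsh j (by omega) i hi
        rw [Finset.sum_range_succ']
        have e : ∑ t ∈ Finset.range j, (n (t + 1) + m' t) + (n 0 + (N + d)) + i =
          n 0 + N + (d + (∑ t ∈ Finset.range j, (n (t + 1) + m' t) + i)) := by ring
        refine (congrArg (splice (x 0) (n 0 + N) x') e).trans ?_
        rw [splice_add, he]
        exact this

theorem exists_shadowing (h : IsKneadingBound s u v) (N : ℕ) :
    ∃ M : ℕ, ∀ (k : ℕ) (x : ℕ → ℕ → ℕ) (C : ℕ → Set ℕ) (n : ℕ → ℕ),
      (∀ j, IsComponent s (C j)) → (∀ j, x j ∈ labels s (C j)) →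
      (∀ j, ∀ a ∈ C j, ∀ b ∈ C (j + 1), Reach s a b) →
      ∃ y ∈ Admissible s, ∃ m : ℕ → ℕ, (∀ j, m j ≤ M) ∧ ∀ j < k, ∀ i < n j + N,
        y (∑ t ∈ Finset.range j, (n t + m t) + i) = x j i := by
  obtain ⟨M, hM⟩ := h.exists_connects_le
  refine ⟨N + M, fun k x C n hC hx hr => ?_⟩
  choose p h1 h2 h3 using fun j => h.exists_path_start_le (hC j) (hx j)
  obtain ⟨y, hy, m, hm⟩ := exists_shadowing_path h.self_mem hM (N := N) k x p n h2 h3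
    fun j l => hr j _ (h1 j l) _ (h1 (j + 1) 0)
  exact ⟨y, mem_admissible_of_mem_followers hy, m, hm⟩

/-! ### The list of components -/

/-- The least vertex reachable from `C` leads back to `C` along the spine, so it belongs to `C`; it
is at most `u + v` because every vertex reaches `u + v`. -/
theorem exists_min_component (h : IsKneadingBound s u v) (hC : IsComponent s C) :
    ∃ r ≤ u + v, Reach s r r ∧ (∀ j < r, ¬ Reach s r j) ∧
      C = {j | Reach s r j ∧ Reach s j r} := by
  classical
  obtain ⟨i, hi, rfl⟩ := hC
  have hex : ∃ j, Reach s i j := ⟨i, hi⟩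
  have h1 : Reach s i (Nat.find hex) := Nat.find_spec hex
  have h2 : Reach s (Nat.find hex) i := by
    rcases (Nat.find_min' hex hi).lt_or_eq with hlt | heq
    · exact reach_of_lt h.self_mem hlt
    · rw [heq]; exact hi
  refine ⟨Nat.find hex, Nat.find_min' hex (h.reach_back i), h2.trans h1,
    fun j hj hr => Nat.find_min hex hj (h1.trans hr), ?_⟩
  ext j
  exact ⟨fun hj => ⟨h2.trans hj.1, hj.2.trans h1⟩, fun hj => ⟨h1.trans hj.1, hj.2.trans h2⟩⟩

theorem exists_list_components (h : IsKneadingBound s u v) :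
    ∃ (q : ℕ) (C : Fin q → Set ℕ), (∀ D, IsComponent s D ↔ ∃ p, C p = D) ∧
      ∀ p p' : Fin q, p < p' → ∀ i ∈ C p, ∀ j ∈ C p', i < j := by
  classical
  set R := (Finset.range (u + v + 1)).filter fun r => Reach s r r ∧ ∀ j < r, ¬ Reach s r j
    with hR
  have hmem : ∀ p, R.orderEmbOfFin rfl p ∈ R := fun p => R.orderEmbOfFin_mem rfl p
  refine ⟨R.card, fun p => {j | Reach s (R.orderEmbOfFin rfl p) j ∧
    Reach s j (R.orderEmbOfFin rfl p)}, fun D => ⟨fun hD => ?_, ?_⟩, fun p p' hp i hi j hj => ?_⟩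
  · obtain ⟨r, h1, h2, h3, rfl⟩ := h.exists_min_component hD
    have hr : r ∈ R := Finset.mem_filter.2 ⟨Finset.mem_range.2 (by omega), h2, h3⟩
    have : r ∈ Set.range (R.orderEmbOfFin rfl) := by rw [Finset.range_orderEmbOfFin]; exact hr
    obtain ⟨p, rfl⟩ := this
    exact ⟨p, rfl⟩
  · rintro ⟨p, rfl⟩
    exact ⟨_, (Finset.mem_filter.1 (hmem p)).2.1, rfl⟩
  -- Otherwise the minimum of the later component would reach `j`, then `i` along the spine, then
  -- the smaller minimum of the earlier component.
  · by_contra! hle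
    exact (Finset.mem_filter.1 (hmem p')).2.2 _ ((R.orderEmbOfFin rfl).strictMono hp)
      ((hj.1.trans_le h.self_mem hle).trans hi.2)

end IsKneadingBound

/-! ### Translation to the graph of the transformation -/

theorem initialWord_length (s : ℕ → ℕ) (n : ℕ) : (initialWord s n).length = n := by
  simp [initialWord]

theorem initialWord_succ (s : ℕ → ℕ) (n : ℕ) : initialWord s (n + 1) = initialWord s n ++ [s n] := by
  simp [initialWord, List.range_succ]

theorem initialWord_eq_iff {s ζ : ℕ → ℕ} {n : ℕ} :
    initialWord ζ n = initialWord s n ↔ ∀ t < n, ζ t = s t := by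
  simp [initialWord, List.map_inj_left]

theorem initialWord_suffix_iff {s ζ : ℕ → ℕ} {n l : ℕ} :
    initialWord s l <:+ initialWord ζ n ↔ IsBorder s ζ n l := by
  constructor
  · intro h
    have hl : l ≤ n := by simpa [initialWord_length] using h.length_le
    refine ⟨hl, fun t ht => ?_⟩
    obtain ⟨w, hw⟩ := h
    have hlen := congrArg List.length hw
    simp only [List.length_append, initialWord_length] at hlen
    have := congrArg (fun L => L[n - l + t]?) hw
    rw [List.getElem?_append_right (by omega), show n - l + t - w.length = t by omega] at this
    simpa [initialWord, ht, show n - l + t < n by omega] using this.symm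
  · rintro ⟨hl, h⟩
    refine ⟨initialWord ζ (n - l), ?_⟩
    refine List.ext_getElem (by simp [initialWord_length]; omega) fun t h1 h2 => ?_
    rw [List.getElem_append]
    split_ifs with h3
    · simp [initialWord]
    · simp only [initialWord_length, not_lt] at h3 h2
      simp only [initialWord, List.getElem_map, List.getElem_range, List.length_map,
        List.length_range]
      rw [← h _ (by omega)]; congr 1; omega

variable {β : ℝ}

theorem edge_eq_step (hβ : 1 < β) : Edge β = Step (kneading β) := by
  funext i a j
  refine propext ?_
  rw [Edge, symbolicSpace_eq_admissible hβ]
  have key : ∀ ζ : ℕ → ℕ, initialWord ζ (i + 1) = initialWord (kneading β) i ++ [a] →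
      (IsGreatest {l | initialWord (kneading β) l <:+ initialWord (kneading β) i ++ [a]} j ↔
        border (kneading β) ζ (i + 1) = j) := by
    intro ζ hζ
    rw [← hζ]
    simp only [initialWord_suffix_iff]
    constructor
    · intro h
      exact le_antisymm (h.2 (isBorder_border _ _ _)) h.1.le_border
    · rintro rfl
      exact ⟨isBorder_border _ _ _, fun l hl => hl.le_border⟩
  constructor
  · rintro ⟨⟨ζ, hζ, hw⟩, hg⟩
    simp only [List.length_append, initialWord_length, List.length_singleton] at hw
    have h := (key ζ hw).1 hg
    rw [initialWord_succ] at hw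
    obtain ⟨h1, h2⟩ := List.append_inj hw (by simp [initialWord_length])
    exact ⟨ζ, hζ, initialWord_eq_iff.1 h1, by simpa using h2, h⟩
  · rintro ⟨ζ, hζ, h1, rfl, h2⟩
    have hw : initialWord ζ (i + 1) = initialWord (kneading β) i ++ [ζ i] := by
      rw [initialWord_succ, initialWord_eq_iff.2 h1]
    refine ⟨⟨ζ, hζ, ?_⟩, (key ζ hw).2 h2⟩
    simpa [initialWord_length] using hw

theorem reaches_eq (hβ : 1 < β) : Reaches β = Reach (kneading β) := by
  funext i j
  rw [Reaches, Reach, edge_eq_step hβ]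

theorem isIrreducibleComponent_iff (hβ : 1 < β) (C : Set ℕ) :
    IsIrreducibleComponent β C ↔ IsComponent (kneading β) C := by
  rw [IsIrreducibleComponent, IsComponent, reaches_eq hβ]

theorem pathLabels_eq (hβ : 1 < β) (C : Set ℕ) : pathLabels β C = labels (kneading β) C := by
  rw [pathLabels, edge_eq_step hβ]
  rfl

theorem exists_isKneadingBound (hβ : 1 < β) (h : EventuallyPeriodic (kneading β)) :
    ∃ u v, IsKneadingBound (kneading β) u v := by
  obtain ⟨u, v, hv, hp⟩ := h
  -- Doubling makes the period even, so that shifting by it preserves the alternating order.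
  refine ⟨u, v + v, kneading_mem_admissible hβ, by omega, ⟨v, rfl⟩, fun k hk => ?_,
    exists_admissible_ne_kneading hβ⟩
  rw [← add_assoc, hp _ (by omega), hp k hk]

/-! ### The metric of the symbolic space -/

theorem dist_le_iff (x y : symbolicSpace β) (N : ℕ) :
    dist x y ≤ (1 / 2) ^ N ↔ ∀ t < N, x.1 t = y.1 t :=
  (@PiNat.mem_cylinder_iff_dist_le (fun _ => ℕ) y.1 x.1 N).symm

theorem shiftOn_iterate (x : symbolicSpace β) (n t : ℕ) :
    ((shiftOn β)^[n] x).1 t = x.1 (n + t) := by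
  induction n generalizing x with
  | zero => simp
  | succ n ih =>
    rw [Function.iterate_succ_apply, ih, show n + 1 + t = n + t + 1 by omega]
    rfl

theorem isNonWandering_iff (x : symbolicSpace β) : IsNonWandering (shiftOn β) x ↔
    ∀ N, ∃ n > 0, ∃ η ∈ symbolicSpace β, (∀ t < N, η t = x.1 t) ∧
      ∀ t < N, η (n + t) = x.1 t := by
  constructor
  · intro h N
    obtain ⟨n, hn, y, hy1, hy2⟩ := h _ (Metric.closedBall_mem_nhds x
      (show (0 : ℝ) < (1 / 2) ^ N by positivity))
    have h1 := (dist_le_iff _ _ _).1 (Metric.mem_closedBall.1 hy1)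
    have h2 := (dist_le_iff _ _ _).1 (Metric.mem_closedBall.1 hy2)
    exact ⟨n, hn, y.1, y.2, h1, fun t ht => by rw [← h2 t ht, shiftOn_iterate]⟩
  · intro h U hU
    obtain ⟨ε, hε, hball⟩ := Metric.nhds_basis_closedBall.mem_iff.1 hU
    obtain ⟨N, hN⟩ := exists_pow_lt_of_lt_one hε (show (1 / 2 : ℝ) < 1 by norm_num)
    obtain ⟨n, hn, η, hη, h1, h2⟩ := h N
    refine ⟨n, hn, ⟨η, hη⟩, hball (Metric.mem_closedBall.2 ?_),
      hball (Metric.mem_closedBall.2 ?_)⟩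
    · exact ((dist_le_iff _ _ _).2 h1).trans hN.le
    · refine ((dist_le_iff _ _ N).2 fun t ht => ?_).trans hN.le
      rw [shiftOn_iterate]; exact h2 t ht

theorem isCompact_of_agree {S X : Set (ℕ → ℕ)} {b : ℕ} (hb : ∀ ω ∈ S, ∀ t, ω t ≤ b)
    (h : ∀ ω, (∀ N, ∃ η ∈ S, ∀ t < N, η t = ω t) → ω ∈ S) (hSX : S ⊆ X) :
    IsCompact {ω : X | ω.1 ∈ S} := by
  have hcl : IsClosed S := isClosed_of_closure_subset fun ω hω =>
    h ω (mem_closure_iff_forall_agree.1 hω)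
  have hc : IsCompact S := (isCompact_univ_pi fun _ : ℕ =>
    (Set.finite_Iic b).isCompact).of_isClosed_subset hcl fun ω hω t _ => hb ω hω t
  rw [Subtype.isCompact_iff]
  convert hc using 1
  ext ω
  constructor
  · rintro ⟨⟨ω, _⟩, h, rfl⟩; exact h
  · exact fun h => ⟨⟨ω, hSX h⟩, h, rfl⟩

/-! ### Assembly of the specification property -/

theorem sum_filter_lt_eq_sum_range {k : ℕ} (f : ℕ → ℕ) (j : Fin k) :
    ∑ t ∈ Finset.univ.filter (fun t : Fin k => t < j), f t = ∑ t ∈ Finset.range j, f t := by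
  rw [show Finset.univ.filter (fun t : Fin k => t < j) = Finset.Iio j by ext; simp,
    ← Fin.map_valEmbedding_Iio j |>.trans (Nat.Iio_eq_range _), Finset.sum_map]
  rfl

theorem oneWayWSpecificationWith_of_isKneadingBound (hβ : 1 < β) {u v : ℕ}
    (h : IsKneadingBound (kneading β) u v) {q : ℕ} {C : Fin q → Set ℕ}
    (hC : ∀ D, IsComponent (kneading β) D ↔ ∃ p, C p = D)
    (hlt : ∀ p p' : Fin q, p < p' → ∀ i ∈ C p, ∀ j ∈ C p', i < j) :
    OneWayWSpecificationWith (shiftOn β)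
      (fun p => {ω : symbolicSpace β | ω.1 ∈ labels (kneading β) (C p)}) := by
  have hX := symbolicSpace_eq_admissible hβ
  have hCp : ∀ p, IsComponent (kneading β) (C p) := fun p => (hC _).2 ⟨p, rfl⟩
  have hsub : ∀ D, labels (kneading β) D ⊆ symbolicSpace β := fun D =>
    hX ▸ labels_subset h.self_mem D
  refine ⟨fun p => ?_, fun p ω hω => ?_, ?_, fun ε hε => ?_⟩
  · refine isCompact_of_agree (b := kneading β 0) (fun ω hω t => ?_)
      (fun ω hω => h.mem_labels_of_forall_exists (hCp p) hω) (hsub _)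
    exact (labels_subset h.self_mem _ hω t 0 (by simp)).1 (by simp)
  · have := labels_shift hω 1
    have e : (shiftOn β ω).1 = fun t => ω.1 (1 + t) := by
      funext t; rw [← shiftOn_iterate]; rfl
    simpa only [mem_ofPred_eq, e] using this
  · ext ω
    rw [mem_ofPred_eq, isNonWandering_iff, mem_iUnion]
    constructor
    · intro hret
      obtain ⟨D, hD, hmem⟩ := h.exists_component_of_returns (hX.subset ω.2) fun N => by
        obtain ⟨n, hn, η, hη, hr⟩ := exists_large_return ω.2 hret N
        exact ⟨n, hn, η, hX.subset hη, hr⟩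
      obtain ⟨p, rfl⟩ := (hC D).1 hD
      exact ⟨p, hmem⟩
    · rintro ⟨p, hp⟩ N
      obtain ⟨n, hn, η, hη, h1, h2⟩ := h.exists_return (hCp p) hp N
      exact ⟨n, hn, η, hX ▸ hη, h1, fun t _ => h2 t⟩
  · obtain ⟨N, hN⟩ := exists_pow_lt_of_lt_one hε (show (1 / 2 : ℝ) < 1 by norm_num)
    obtain ⟨M, hM⟩ := h.exists_shadowing N
    refine ⟨M, fun k c x n hk hc hx hn => ?_⟩
    -- The finite family is extended to all of ℕ by repeating its last member, which keeps the
    -- component indices monotone.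
    let idx : ℕ → Fin k := fun j => ⟨min j (k - 1), by omega⟩
    have hidx : ∀ j : Fin k, idx j = j := fun j => Fin.ext (by
      have := j.2
      simp only [idx]
      omega)
    have hmono : ∀ j, idx j ≤ idx (j + 1) := fun j => by
      simp only [idx, Fin.mk_le_mk]
      omega
    obtain ⟨y, hy, m, hm, hsh⟩ := hM k (fun j => (x (idx j)).1) (fun j => C (c (idx j)))
      (fun j => n (idx j)) (fun j => hCp _) (fun j => hx _) (fun j a ha b hb => by
        rcases (hc (hmono j)).lt_or_eq with hlt' | heq
        · exact reach_of_lt h.self_mem (hlt _ _ hlt' a ha b hb)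
        · rw [← heq] at hb
          exact (hCp _).reach ha hb)
    refine ⟨⟨y, hX ▸ hy⟩, fun j => m j, fun j => hm j, fun j i hi => ?_⟩
    refine ((dist_le_iff _ _ N).2 fun t ht => ?_).trans hN.le
    have hsum := sum_filter_lt_eq_sum_range (fun t => n (idx t) + m t) j
    simp only [hidx] at hsum
    have := hsh j j.2 (i + t) (by simp only [hidx]; omega)
    rw [shiftOn_iterate, shiftOn_iterate, hsum]
    simp only [hidx] at this
    rw [← this]
    dsimp only
    congr 1
    omega

end NegBeta

theorem proposition3p3 (β : ℝ) (hβ : 1 < β)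
    (hper : NegBeta.EventuallyPeriodic (NegBeta.kneading β)) :
    -- the symbolic space has the one-way (W)-specification property
    OneWayWSpecification (NegBeta.shiftOn β) ∧
    -- the graph presents the symbolic space
    NegBeta.symbolicSpace β = NegBeta.pathLabels β univ ∧
    -- there are finitely many irreducible components, linearly ordered by their vertices, and the
    -- property holds with the subshifts that they generate, taken in this order
    ∃ (q : ℕ) (C : Fin q → Set ℕ),
      (∀ D : Set ℕ, NegBeta.IsIrreducibleComponent β D ↔ ∃ p, C p = D) ∧
      (∀ p p' : Fin q, p < p' → ∀ i ∈ C p, ∀ j ∈ C p', i < j) ∧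
      OneWayWSpecificationWith (NegBeta.shiftOn β)
        (fun p => {ω : NegBeta.symbolicSpace β | (ω : ℕ → ℕ) ∈ NegBeta.pathLabels β (C p)}) := by
  obtain ⟨u, v, h⟩ := NegBeta.exists_isKneadingBound hβ hper
  obtain ⟨q, C, hC, hlt⟩ := h.exists_list_components
  have hspec := NegBeta.oneWayWSpecificationWith_of_isKneadingBound hβ h hC hlt
  simp only [NegBeta.pathLabels_eq hβ, NegBeta.isIrreducibleComponent_iff hβ]
  exact ⟨⟨q, _, hspec⟩,
    (NegBeta.symbolicSpace_eq_admissible hβ).trans (NegBeta.labels_univ h.self_mem).symm,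
    q, C, hC, hlt, hspec⟩
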